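/- Setting. Let $d\ge 1$, let $K\subseteq\mathbb R^d$ be a convex body (compact, convex, with non-empty interior) with diameter $\delta_K$, and write $|\cdot|$ for Lebesgue measure and $\|f\|_S:=\sup_{x\in S}|f(x)|$. Let $\mu=(\mu_j)_{j\ge1}$ be a sequence of real numbers with $0<\mu_1\le\mu_2\le\cdots$ such that $$\sum_{j=1}^\infty\frac1{\mu_j}>\delta_K\,e$$ (the sum may be infinite), and let $$N:=1+\sup\Big\{n\in\mathbb N:\ \sum_{j=1}^n\frac1{\delta_K\mu_j}<e\Big\},$$ which is a finite positive integer. Let $\tilde\mu:[1,\infty)\to(0,\infty)$ be any increasing, continuous, piecewise $C^1$ function with $\tilde\mu(k)=\mu_k$ for all integers $k\ge1$, and put $$\gamma(n):=\sup_{1\le s\le n}\frac{s\,\tilde\mu'(s)}{\tilde\mu(s)},\qquad C_N:=4\,e^{4+\gamma(2(N-1))},$$ where $\tilde\mu'$ is the left derivative (at $s=1$ the right derivative). Theorem. Assume $N\ge2$. Let $f:K\to\mathbb R$ be of class $C^{2(N-1)}$ in an open neighbourhood of $K$, with $\|f\|_K>0$ and $$\sum_{|\alpha|=j}\frac{j!}{\alpha!}\,\|f^{(\alpha)}\|_K\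 \le\ \|f\|_K\,\mu_1\mu_2\cdots\mu_j\qquad\text{for all }0\le j\le 2(N-1).$$ Then for every Lebesgue measurable $E\subseteq K$ with $|E|>0$, $$\|f\|_K\le\Big(\frac{C_N\,|K|^{1/d}}{|K|^{1/d}-(|K|-|E|)^{1/d}}\Big)^{2(N-1)}\|f\|_E .$$ -/

import Mathlib

open MeasureTheory Set Filter
open scoped ENNReal

noncomputable section

namespace RemezSmooth

/-- A positive, increasing, everywhere finite sequence `(μ_j)_{j ≥ 1}`
(the entry with index `0` plays no role). -/
structure IsAdmissibleWeight (μ : ℕ → ℝ) : Prop where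
  pos : ∀ j, 1 ≤ j → 0 < μ j
  mono : ∀ j k, 1 ≤ j → j ≤ k → μ j ≤ μ k

/-- Convex bodies: compact convex sets with non-empty interior. -/
structure IsConvexBody {d : ℕ} (K : Set (EuclideanSpace ℝ (Fin d))) : Prop where
  convex : Convex ℝ K
  compact : IsCompact K
  interior_nonempty : (interior K).Nonempty

/-- The supremum of `|f|` over `S`. It is only used for non-empty `S` on which `f` is bounded. -/
def supNorm {d : ℕ} (S : Set (EuclideanSpace ℝ (Fin d))) (f : EuclideanSpace ℝ (Fin d) → ℝ) : ℝ :=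
  ⨆ x : S, |f x|

/-- The partial derivative `∂_i f`. -/
def partialDeriv {d : ℕ} (i : Fin d) (f : EuclideanSpace ℝ (Fin d) → ℝ) :
    EuclideanSpace ℝ (Fin d) → ℝ :=
  fun x => lineDeriv ℝ f x (EuclideanSpace.single i 1)

/-- The partial derivative `f^{(α)} = ∂_1^{α_1} ⋯ ∂_d^{α_d} f` for a multi-index `α`. -/
def multiDeriv {d : ℕ} (α : Fin d → ℕ) (f : EuclideanSpace ℝ (Fin d) → ℝ) :
    EuclideanSpace ℝ (Fin d) → ℝ :=
  (List.finRange d).foldr (fun i g => (partialDeriv i)^[α i] g) f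

/-- `‖f‖_{j,S} = ∑_{|α| = j} (j! / α!) ‖f^{(α)}‖_S`. -/
def derivNorm {d : ℕ} (j : ℕ) (S : Set (EuclideanSpace ℝ (Fin d)))
    (f : EuclideanSpace ℝ (Fin d) → ℝ) : ℝ :=
  ∑ α ∈ Finset.piAntidiag (Finset.univ : Finset (Fin d)) j,
    ((j.factorial : ℝ) / ∏ i, ((α i).factorial : ℝ)) * supNorm S (multiDeriv α f)

/-- `f` is `(μ^{|n}, M₀)`-smooth on `K`, where `μ^{|n} = (μ_1, …, μ_n, ∞, ∞, …)`: it is of class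
`C^n` in an open neighbourhood of `K`, and `‖f‖_{j,K} ≤ M₀ μ_1 ⋯ μ_j` for all finite `j ≤ n`. -/
structure IsWeightSmooth {d : ℕ} (μ : ℕ → ℝ) (n : ℕ∞) (M₀ : ℝ)
    (K : Set (EuclideanSpace ℝ (Fin d))) (f : EuclideanSpace ℝ (Fin d) → ℝ) : Prop where
  pos : 0 < M₀
  contDiff : ∃ U : Set (EuclideanSpace ℝ (Fin d)), IsOpen U ∧ K ⊆ U ∧ ContDiffOn ℝ n f U
  bound : ∀ j : ℕ, (j : ℕ∞) ≤ n → derivNorm j K f ≤ M₀ * ∏ i ∈ Finset.Icc 1 j, μ i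

/-- `Σ_μ(m, n) = ∑_{j = m}^n 1 / μ_j` (zero if `m > n`). -/
def weightSum (μ : ℕ → ℝ) (m n : ℕ) : ℝ :=
  ∑ j ∈ Finset.Icc m n, 1 / μ j

/-- `Σ_μ(m, ∞) = ∑_{j ≥ m} 1 / μ_j`, possibly infinite. -/
def weightSumTop (μ : ℕ → ℝ) (m : ℕ) : ℝ≥0∞ :=
  ∑' j : ℕ, ENNReal.ofReal (1 / μ (m + j))

/-- `j₀(b)`, the smallest natural number `j` with `j ≥ log (1 / b)`. -/
def startIndex (b : ℝ) : ℕ := ⌈Real.log b⁻¹⌉₊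

/-- The `μ`-degree `sup {n ∈ ℕ : Σ_μ(j₀(b) + 1, n) < e}`, an element of `ℕ ∪ {∞}`. -/
def weightDegree (μ : ℕ → ℝ) (b : ℝ) : ℕ∞ :=
  ⨆ n ∈ {n : ℕ | weightSum μ (startIndex b + 1) n < Real.exp 1}, (n : ℕ∞)

/-- `(μ, K)` is admissible data: `Σ_μ(1, ∞) > diam(K) e`. -/
structure IsAdmissibleData {d : ℕ} (μ : ℕ → ℝ) (K : Set (EuclideanSpace ℝ (Fin d))) : Prop where
  weight : IsAdmissibleWeight μ
  convexBody : IsConvexBody K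
  sum_gt : ENNReal.ofReal (Metric.diam K * Real.exp 1) < weightSumTop μ 1

/-- `N` is the integer associated with the admissible data `(μ, K)`, that is, `N - 1` is the
degree, at `b = 1`, of the weight `(diam(K) μ_j)_j`. -/
def IsAssociatedInteger {d : ℕ} (μ : ℕ → ℝ) (K : Set (EuclideanSpace ℝ (Fin d))) (N : ℕ) : Prop :=
  (N : ℕ∞) = weightDegree (fun j => Metric.diam K * μ j) 1 + 1

/-- `g` is an increasing, positive, continuous, piecewise `C¹` function on `[1, ∞)` with
`g(k) = μ_k` for all integers `k ≥ 1`. -/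
structure IsInterpolation (μ : ℕ → ℝ) (g : ℝ → ℝ) : Prop where
  pos : ∀ s, 1 ≤ s → 0 < g s
  mono : MonotoneOn g (Ici 1)
  cont : ContinuousOn g (Ici 1)
  piecewise : ∃ t : ℕ → ℝ, StrictMono t ∧ t 0 = 1 ∧ Tendsto t atTop atTop ∧
    ∀ i, ContDiffOn ℝ 1 g (Icc (t i) (t (i + 1)))
  interp : ∀ k : ℕ, 1 ≤ k → g k = μ k

/-- The left derivative of a function on `[1, ∞)`; at the end point `1` the right derivative. -/
def leftDeriv (g : ℝ → ℝ) (s : ℝ) : ℝ :=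
  if s = 1 then derivWithin g (Ici 1) 1 else derivWithin g (Iic s) s

/-- `γ_g(n) = sup_{1 ≤ s ≤ n} s g'(s) / g(s)`. -/
def gammaExp (g : ℝ → ℝ) (n : ℕ) : ℝ :=
  ⨆ s : Icc (1 : ℝ) n, (s : ℝ) * leftDeriv g s / g s

/-- `Γ_g(n) = 4 exp(4 + γ_g(n))`. -/
def gammaConst (g : ℝ → ℝ) (n : ℕ) : ℝ :=
  4 * Real.exp (4 + gammaExp g n)

end RemezSmooth

end

/-!
Let `δ` be the diameter of `K` and `n = N - 1`. Parametrize a segment of `K` that ends at a maximum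
point of `|f|` by `[0, 1]` and restrict `f` to it. If at some point all derivatives of order `< n`
were small at the scale of the weights `δ μ_j`, then Taylor's theorem, applied successively over
steps of length `1 / (e δ μ_j)`, would propagate this smallness to the maximum point with a loss of
a factor `e` per step, because these lengths add up to more than `1` (Bang). So at every point of
the segment some derivative of order `j < n` is large. On the other hand, a short interval in which
`{|f| ≤ ε}` is dense contains `2 n` well-spaced points of that set. Lagrange interpolation there
bounds the derivative of order `j` by a multiple of `ε` plus a remainder, controlled by the
derivative of order `2 n`, which is too small to account for it. This bounds `ε` from below.

In several variables, polar coordinates around the maximum point show that some segment ending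
there meets `E` in a proportion of about `1 - (1 - |E| / |K|) ^ (1 / d)`: on each ray, removing a
given proportion removes the least mass `r ^ (d - 1) dr` when it removes an initial segment.
-/

namespace RemezSmooth

/-! ### Weights -/

/-- The bound `A μ_1 ⋯ μ_j` that `(μ, A)`-smoothness imposes on derivatives of order `j`. -/
def majorant (μ : ℕ → ℝ) (A : ℝ) (j : ℕ) : ℝ :=
  A * ∏ i ∈ Finset.Icc 1 j, μ i

section Weights

variable {μ : ℕ → ℝ} {A : ℝ} {j k n q : ℕ}

theorem IsAdmissibleWeight.const_mul (hμ : IsAdmissibleWeight μ) {c : ℝ} (hc : 0 < c) :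
    IsAdmissibleWeight fun j => c * μ j where
  pos j hj := mul_pos hc (hμ.pos j hj)
  mono j k hj hjk := mul_le_mul_of_nonneg_left (hμ.mono j k hj hjk) hc.le

theorem IsInterpolation.isAdmissibleWeight {g : ℝ → ℝ} (hg : IsInterpolation μ g) :
    IsAdmissibleWeight μ where
  pos j hj := by
    rw [← hg.interp j hj]
    exact hg.pos _ (by exact_mod_cast hj)
  mono j k hj hjk := by
    rw [← hg.interp j hj, ← hg.interp k (hj.trans hjk)]
    exact hg.mono (mem_Ici.2 (by exact_mod_cast hj)) (mem_Ici.2 (by exact_mod_cast hj.trans hjk))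
      (by exact_mod_cast hjk)

@[simp]
theorem majorant_zero : majorant μ A 0 = A := by simp [majorant]

theorem majorant_succ (μ : ℕ → ℝ) (A : ℝ) (j : ℕ) :
    majorant μ A (j + 1) = majorant μ A j * μ (j + 1) := by
  rw [majorant, majorant, Finset.prod_Icc_succ_top (by lia), mul_assoc]

theorem pow_mul_majorant (c : ℝ) (μ : ℕ → ℝ) (A : ℝ) (j : ℕ) :
    c ^ j * majorant μ A j = majorant (fun i => c * μ i) A j := by
  simp only [majorant, Finset.prod_mul_distrib, Finset.prod_const, Nat.card_Icc,
    Nat.add_sub_cancel]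
  ring

theorem majorant_pos (hμ : IsAdmissibleWeight μ) (hA : 0 < A) (j : ℕ) : 0 < majorant μ A j :=
  mul_pos hA (Finset.prod_pos fun i hi => hμ.pos i (Finset.mem_Icc.1 hi).1)

theorem majorant_le_mul_pow (hμ : IsAdmissibleWeight μ) (hA : 0 < A) (hjk : j ≤ k) :
    majorant μ A k ≤ majorant μ A j * μ k ^ (k - j) := by
  have hle : ∀ r, j + r ≤ k → majorant μ A (j + r) ≤ majorant μ A j * μ k ^ r := by
    intro r hr
    induction r with
    | zero => simp
    | succ r ih =>
      have hpos := (majorant_pos hμ hA (j + r)).le.trans (ih (by lia))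
      rw [← add_assoc, majorant_succ, pow_succ, ← mul_assoc]
      exact mul_le_mul (ih (by lia)) (hμ.mono _ _ (by lia) hr) (hμ.pos _ (by lia)).le hpos
  simpa [Nat.add_sub_cancel' hjk] using hle (k - j) (by lia)

theorem pow_mul_exp_neg_le_majorant (hμ : IsAdmissibleWeight μ) (hA : 0 < A) (hq : 1 ≤ q) {γ : ℝ}
    (hγ₀ : 0 ≤ γ) (hγ : ∀ i, 1 ≤ i → i ≤ q → μ q * ((i : ℝ) / q) ^ γ ≤ μ i) (hj : j ≤ q) :
    A * (μ q ^ j * Real.exp (-(q * γ))) ≤ majorant μ A j := by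
  have hq₀ : (0 : ℝ) < q := by exact_mod_cast hq
  have hμq := hμ.pos q hq
  have hfactorial : Real.exp (-q) ≤ ∏ i ∈ Finset.Icc 1 j, (i : ℝ) / q := by
    rw [Finset.prod_div_distrib, Finset.prod_const, Nat.card_Icc, Nat.add_sub_cancel,
      ← Nat.cast_prod, ← Finset.Ico_add_one_right_eq_Icc, Finset.prod_Ico_id_eq_factorial,
      Real.exp_neg, inv_le_comm₀ (Real.exp_pos _) (by positivity), inv_div]
    exact Real.pow_div_factorial_le_exp _ hq₀.le j
  refine mul_le_mul_of_nonneg_left ?_ hA.le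
  calc μ q ^ j * Real.exp (-(q * γ))
      = μ q ^ j * Real.exp (-q) ^ γ := by rw [← neg_mul, Real.exp_mul]
    _ ≤ μ q ^ j * (∏ i ∈ Finset.Icc 1 j, (i : ℝ) / q) ^ γ := by gcongr
    _ = ∏ i ∈ Finset.Icc 1 j, μ q * ((i : ℝ) / q) ^ γ := by
      rw [← Real.finsetProd_rpow _ _ fun i _ => by positivity, Finset.prod_mul_distrib,
        Finset.prod_const, Nat.card_Icc, Nat.add_sub_cancel]
    _ ≤ ∏ i ∈ Finset.Icc 1 j, μ i :=
      Finset.prod_le_prod (fun i _ => by positivity) fun i hi =>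
        hγ i (Finset.mem_Icc.1 hi).1 ((Finset.mem_Icc.1 hi).2.trans hj)

theorem weightSum_succ (μ : ℕ → ℝ) (n : ℕ) :
    weightSum μ 1 (n + 1) = weightSum μ 1 n + 1 / μ (n + 1) :=
  Finset.sum_Icc_succ_top (by lia) _

theorem natCast_div_le_weightSum (hμ : IsAdmissibleWeight μ) (hnq : n ≤ q) :
    n / μ q ≤ weightSum μ 1 n := by
  have hle : ∀ i ∈ Finset.Icc 1 n, 1 / μ q ≤ 1 / μ i := fun i hi =>
    have hi' := Finset.mem_Icc.1 hi
    one_div_le_one_div_of_le (hμ.pos i hi'.1) (hμ.mono i q hi'.1 (hi'.2.trans hnq))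
  simpa [weightSum, div_eq_mul_inv] using Finset.card_nsmul_le_sum _ _ _ hle

end Weights

/-! ### Jets on an interval and Bang's theorem -/

/-- `G 0, G 1, …, G n` is a chain of successive derivatives on `s`. Derivatives of functions of
several variables along a line come as such chains, with no iterated derivatives involved. -/
def IsDerivChain {F : Type*} [NormedAddCommGroup F] [NormedSpace ℝ F] (n : ℕ) (s : Set ℝ)
    (G : ℕ → ℝ → F) : Prop :=
  ∀ j < n, ∀ t ∈ s, HasDerivWithinAt (G j) (G (j + 1) t) s t

/-- A chain of derivatives of order `n` on `s` that is `(μ, A)`-smooth: the one-dimensional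
counterpart of `IsWeightSmooth`. -/
structure IsWeightJet {F : Type*} [NormedAddCommGroup F] [NormedSpace ℝ F] (μ : ℕ → ℝ) (n : ℕ)
    (A : ℝ) (s : Set ℝ) (G : ℕ → ℝ → F) : Prop where
  pos : 0 < A
  chain : IsDerivChain n s G
  bound : ∀ j ≤ n, ∀ t ∈ s, ‖G j t‖ ≤ majorant μ A j

/-- The derivatives of order `< k` at `y` are small at the scale of `exp (j - k)`, the bound that
Bang's argument propagates along an interval. -/
def IsSmallJet {F : Type*} [NormedAddCommGroup F] (μ : ℕ → ℝ) (A : ℝ) (k : ℕ) (G : ℕ → ℝ → F)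
    (y : ℝ) : Prop :=
  ∀ j < k, ‖G j y‖ ≤ Real.exp (j - k) * majorant μ A j

section Jets

variable {F : Type*} [NormedAddCommGroup F] [NormedSpace ℝ F] {μ : ℕ → ℝ} {A a b x y : ℝ}
  {k m n : ℕ} {s t : Set ℝ} {G H : ℕ → ℝ → F}

theorem IsDerivChain.mono (hG : IsDerivChain n t G) (hmn : m ≤ n) (hst : s ⊆ t) :
    IsDerivChain m s G :=
  fun j hj x hx => (hG j (hj.trans_le hmn) x (hst hx)).mono hst

theorem IsDerivChain.sub (hG : IsDerivChain n s G) (hH : IsDerivChain n s H) :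
    IsDerivChain n s fun j t => G j t - H j t :=
  fun j hj t ht => (hG j hj t ht).sub (hH j hj t ht)

theorem IsDerivChain.continuousOn (hG : IsDerivChain n s G) (hk : k < n) : ContinuousOn (G k) s :=
  fun t ht => (hG k hk t ht).continuousWithinAt

theorem IsWeightJet.mono (hG : IsWeightJet μ n A t G) (hmn : m ≤ n) (hst : s ⊆ t) :
    IsWeightJet μ m A s G where
  pos := hG.pos
  chain := hG.chain.mono hmn hst
  bound j hj x hx := hG.bound j (hj.trans hmn) x (hst hx)

theorem IsWeightJet.norm_le_of_isSmallJet (hμ : IsAdmissibleWeight μ)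
    (hG : IsWeightJet μ n A (Icc a b) G) (hy : IsSmallJet μ A k G a) (hk : 1 ≤ k) (hkn : k ≤ n)
    {j : ℕ} (hj : j ≤ k) (hx : x ∈ Icc a b) :
    ‖G j x‖ ≤ Real.exp (j - k) * majorant μ A j * Real.exp (Real.exp 1 * μ k * (x - a)) := by
  have hμk := hμ.pos k hk
  induction hj using Nat.decreasingInduction generalizing x with
  | self =>
    have hone : 1 ≤ Real.exp (Real.exp 1 * μ k * (x - a)) :=
      Real.one_le_exp (mul_nonneg (by positivity) (sub_nonneg.2 hx.1))
    simpa using (hG.bound k hkn x hx).trans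
      (le_mul_of_one_le_right (majorant_pos hμ hG.pos k).le hone)
  | of_succ j hj ih =>
    let B : ℝ → ℝ := fun t =>
      Real.exp (j - k) * majorant μ A j * Real.exp (Real.exp 1 * μ k * (t - a))
    have hB : ∀ t, HasDerivAt B (B t * (Real.exp 1 * μ k)) t := fun t => by
      have := (((hasDerivAt_id t).sub_const a).const_mul (Real.exp 1 * μ k)).exp.const_mul
        (Real.exp (j - k) * majorant μ A j)
      simpa [B, mul_assoc] using this
    refine image_norm_le_of_norm_deriv_right_le_deriv_boundary
      (hG.chain.continuousOn (hj.trans_le hkn)) (fun t ht =>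
        (hG.chain j (hj.trans_le hkn) t (Ico_subset_Icc_self ht)).mono_of_mem_nhdsWithin
          (Icc_mem_nhdsGE_of_mem ht)) ?_ hB (fun t ht => ?_) hx
    · simpa [B] using hy j hj
    · have hexp : Real.exp ((j + 1 : ℕ) - k) = Real.exp (j - k) * Real.exp 1 := by
        rw [← Real.exp_add]
        push_cast
        ring_nf
      have hstep : majorant μ A (j + 1) ≤ majorant μ A j * μ k := by
        rw [majorant_succ]
        exact mul_le_mul_of_nonneg_left (hμ.mono _ _ (by lia) hj) (majorant_pos hμ hG.pos j).le
      calc ‖G (j + 1) t‖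
          ≤ Real.exp (j - k) * Real.exp 1 * majorant μ A (j + 1) *
              Real.exp (Real.exp 1 * μ k * (t - a)) := hexp ▸ ih (Ico_subset_Icc_self ht)
        _ ≤ Real.exp (j - k) * Real.exp 1 * (majorant μ A j * μ k) *
              Real.exp (Real.exp 1 * μ k * (t - a)) := by gcongr
        _ = B t * (Real.exp 1 * μ k) := by ring

theorem IsWeightJet.isSmallJet_pred (hμ : IsAdmissibleWeight μ)
    (hG : IsWeightJet μ n A (Icc a b) G) (ha : IsSmallJet μ A (k + 1) G a) (hkn : k + 1 ≤ n)
    (hx : x ∈ Icc a b) (hxa : Real.exp 1 * (x - a) ≤ 1 / μ (k + 1)) : IsSmallJet μ A k G x := by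
  intro j hj
  have hμk := hμ.pos (k + 1) (by lia)
  have hexp : Real.exp 1 * μ (k + 1) * (x - a) ≤ 1 := by
    rw [le_div_iff₀ hμk] at hxa
    linarith
  have hM := majorant_pos hμ hG.pos j
  calc ‖G j x‖
      ≤ Real.exp (j - (k + 1 : ℕ)) * majorant μ A j *
          Real.exp (Real.exp 1 * μ (k + 1) * (x - a)) :=
        hG.norm_le_of_isSmallJet hμ ha (by lia) hkn (by lia) hx
    _ ≤ Real.exp (j - (k + 1 : ℕ)) * majorant μ A j * Real.exp 1 := by gcongr
    _ = Real.exp (j - k) * majorant μ A j := by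
      rw [mul_right_comm, ← Real.exp_add]
      push_cast
      ring_nf

theorem IsWeightJet.norm_lt_of_isSmallJet_one (hμ : IsAdmissibleWeight μ)
    (hG : IsWeightJet μ n A (Icc a b) G) (ha : IsSmallJet μ A 1 G a) (hn : 1 ≤ n)
    (hab : a ≤ b) (hba : Real.exp 1 * (b - a) ≤ 1 / μ 1) : ‖G 0 b‖ < A := by
  have hA := hG.pos
  have hμ₁ := hμ.pos 1 le_rfl
  have hmeanValue : ‖G 0 b - G 0 a‖ ≤ A * μ 1 * ‖b - a‖ :=
    (convex_Icc a b).norm_image_sub_le_of_norm_hasDerivWithin_le (hG.chain 0 hn)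
      (fun t ht => by simpa [majorant] using hG.bound 1 hn t ht) (left_mem_Icc.2 hab)
      (right_mem_Icc.2 hab)
  have hsmall : ‖G 0 a‖ ≤ Real.exp (-1) * A := by simpa using ha 0 one_pos
  have hlength : μ 1 * (b - a) ≤ Real.exp (-1) := by
    rw [le_div_iff₀ hμ₁] at hba
    rw [Real.exp_neg, ← one_div, le_div_iff₀ (Real.exp_pos 1)]
    linarith
  have hexp : Real.exp (-1) < 1 / 2 := Real.exp_neg_one_lt_half
  rw [Real.norm_of_nonneg (sub_nonneg.2 hab)] at hmeanValue
  have htriangle := norm_sub_norm_le (G 0 b) (G 0 a)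
  nlinarith

theorem IsWeightJet.norm_lt_of_isSmallJet (hμ : IsAdmissibleWeight μ) (hk : 1 ≤ k) (hkn : k ≤ n)
    (hG : IsWeightJet μ n A (Icc a b) G) (hab : a ≤ b) (ha : IsSmallJet μ A k G a)
    (hba : Real.exp 1 * (b - a) ≤ weightSum μ 1 k) : ‖G 0 b‖ < A := by
  induction k, hk using Nat.le_induction generalizing a with
  | base =>
    exact hG.norm_lt_of_isSmallJet_one hμ ha hkn hab (by simpa [weightSum] using hba)
  | succ k hk ih =>
    rw [weightSum_succ] at hba
    have hμk := hμ.pos (k + 1) (by lia)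
    rcases le_total (Real.exp 1 * (b - a)) (1 / μ (k + 1)) with hshort | hlong
    · have hsmall := hG.isSmallJet_pred hμ ha hkn (right_mem_Icc.2 hab) hshort 0 hk
      have hexp : Real.exp (-k) < 1 := Real.exp_lt_one_iff.2 (neg_lt_zero.2 (Nat.cast_pos.2 hk))
      calc ‖G 0 b‖ ≤ Real.exp (-k) * A := by simpa using hsmall
        _ < A := mul_lt_of_lt_one_left hG.pos hexp
    · set c := a + 1 / μ (k + 1) / Real.exp 1 with hc
      have hca : Real.exp 1 * (c - a) = 1 / μ (k + 1) := by
        rw [hc, add_sub_cancel_left, mul_div_cancel₀ _ (Real.exp_ne_zero 1)]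
      have hac : a ≤ c := le_add_of_nonneg_right (by positivity)
      have hcb : c ≤ b := by nlinarith [Real.exp_pos 1]
      exact ih (by lia) (hG.mono le_rfl (Icc_subset_Icc_left hac)) hcb
        (hG.isSmallJet_pred hμ ha hkn ⟨hac, hcb⟩ hca.le) (by linarith)

theorem IsWeightJet.exists_large_deriv (hμ : IsAdmissibleWeight μ) (hn : 1 ≤ n)
    (hG : IsWeightJet μ n A (Icc a b) G) (hsum : Real.exp 1 * (b - a) ≤ weightSum μ 1 n)
    (hb : A ≤ ‖G 0 b‖) (hx : x ∈ Icc a b) :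
    ∃ j < n, Real.exp (j - n) * majorant μ A j < ‖G j x‖ := by
  by_contra! hsmall
  refine hb.not_gt ((hG.mono le_rfl (Icc_subset_Icc_left hx.1)).norm_lt_of_isSmallJet hμ hn le_rfl
    hx.2 hsmall (le_trans ?_ hsum))
  gcongr
  exact hx.1

end Jets

/-! ### Interpolation at well spaced nodes -/

/-- The points `z 0 < z 1 < ⋯ < z k` have consecutive gaps at least `s`. -/
def IsSpaced (s : ℝ) (k : ℕ) (z : ℕ → ℝ) : Prop :=
  ∀ i < k, z i + s ≤ z (i + 1)

section Interpolation

open Polynomial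

variable {a b s x A h ε : ℝ} {i j k m n r : ℕ} {S : Set ℝ} {Z : Finset ℝ} {G U : ℕ → ℝ → ℝ}
  {z : ℕ → ℝ} {P : ℝ[X]}

theorem IsDerivChain.shift (hU : IsDerivChain (m + n) S U) :
    IsDerivChain n S fun j => U (m + j) :=
  fun j hj => hU (m + j) (by lia)

theorem isDerivChain_eval_iterate_derivative (P : ℝ[X]) (n : ℕ) (S : Set ℝ) :
    IsDerivChain n S fun j t => (derivative^[j] P).eval t := fun j _ t _ => by
  simpa only [Function.iterate_succ_apply'] using
    (Polynomial.hasDerivAt (derivative^[j] P) t).hasDerivWithinAt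

theorem exists_zeros_of_hasDerivWithinAt {g g' : ℝ → ℝ}
    (hg : ∀ t ∈ Icc a b, HasDerivWithinAt g (g' t) (Icc a b) t)
    (hcard : Z.card = r + 1) (hZ : ∀ z ∈ Z, z ∈ Icc a b ∧ g z = 0) :
    ∃ Z' : Finset ℝ, Z'.card = r ∧ ∀ z ∈ Z', z ∈ Icc a b ∧ g' z = 0 := by
  set z := Z.orderEmbOfFin hcard
  have hz : ∀ i, z i ∈ Icc a b ∧ g (z i) = 0 := fun i => hZ _ (Z.orderEmbOfFin_mem hcard i)
  have hrolle : ∀ i : Fin r, ∃ c ∈ Ioo (z i.castSucc) (z i.succ), g' c = 0 := by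
    intro i
    have hsub : Icc (z i.castSucc) (z i.succ) ⊆ Icc a b := Icc_subset_Icc (hz _).1.1 (hz _).1.2
    refine exists_hasDerivAt_eq_zero (z.strictMono i.castSucc_lt_succ)
      (fun t ht => (hg t (hsub ht)).continuousWithinAt.mono hsub)
      (by rw [(hz _).2, (hz _).2]) fun t ht => ?_
    exact ((hg t (hsub (Ioo_subset_Icc_self ht))).mono hsub).hasDerivAt
      (Icc_mem_nhds ht.1 ht.2)
  choose c hc hc₀ using hrolle
  have hmono : StrictMono c := fun i i' hii =>
    (hc i).2.trans_le ((z.monotone (Fin.succ_le_castSucc_iff.2 hii)).trans (hc i').1.le)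
  refine ⟨Finset.univ.image c, ?_, ?_⟩
  · simp [Finset.card_image_of_injective _ hmono.injective]
  · rintro _ hw
    obtain ⟨i, -, rfl⟩ := Finset.mem_image.1 hw
    exact ⟨⟨(hz _).1.1.trans (hc i).1.le, (hc i).2.le.trans (hz _).1.2⟩, hc₀ i⟩

theorem IsDerivChain.exists_zeros (hU : IsDerivChain n (Icc a b) U) (hcard : Z.card = r + n)
    (hZ : ∀ z ∈ Z, z ∈ Icc a b ∧ U 0 z = 0) :
    ∃ Z' : Finset ℝ, Z'.card = r ∧ ∀ z ∈ Z', z ∈ Icc a b ∧ U n z = 0 := by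
  induction n generalizing r with
  | zero => exact ⟨Z, hcard, hZ⟩
  | succ n ih =>
    obtain ⟨Z₁, hcard₁, hZ₁⟩ :=
      ih (r := r + 1) (hU.mono n.le_succ Subset.rfl) (by lia)
    exact exists_zeros_of_hasDerivWithinAt (hU n n.lt_succ_self) hcard₁ hZ₁

theorem IsDerivChain.exists_mul_prod_eq (hU : IsDerivChain k (Icc a b) U) (hcard : Z.card = k)
    (hZ : ∀ z ∈ Z, z ∈ Icc a b ∧ U 0 z = 0) (hx : x ∈ Icc a b) :
    ∃ ξ ∈ Icc a b, U 0 x * k.factorial = U k ξ * ∏ z ∈ Z, (x - z) := by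
  by_cases hxZ : x ∈ Z
  · exact ⟨x, hx, by rw [(hZ x hxZ).2, Finset.prod_eq_zero hxZ (sub_self x), zero_mul, mul_zero]⟩
  set Q : ℝ[X] := ∏ z ∈ Z, (X - C z)
  have hQ : ∀ y, Q.eval y = ∏ z ∈ Z, (y - z) := by simp [Q, eval_prod]
  have hQx : Q.eval x ≠ 0 := by
    rw [hQ, Finset.prod_ne_zero_iff]
    exact fun z hz hxz => hxZ (sub_eq_zero.1 hxz ▸ hz)
  set c := U 0 x / Q.eval x with hc
  have hQk : derivative^[k] Q = (k.factorial : ℝ[X]) := by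
    rw [iterate_derivative_prod_X_sub_C hcard.ge, hcard]
    simp
  obtain ⟨Z', hcard', hZ'⟩ := (hU.sub
    (isDerivChain_eval_iterate_derivative (C c * Q) k (Icc a b))).exists_zeros (r := 1)
    (Z := insert x Z) (by rw [Finset.card_insert_of_notMem hxZ, hcard, add_comm]) (by
      intro z hz
      rcases Finset.mem_insert.1 hz with rfl | hz
      · exact ⟨hx, by simp [hc, div_mul_cancel₀ _ hQx]⟩
      · exact ⟨(hZ z hz).1, by simp [(hZ z hz).2, hQ, Finset.prod_eq_zero hz (sub_self z)]⟩)
  obtain ⟨ξ, hξ⟩ : Z'.Nonempty := Finset.card_pos.1 (by lia)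
  obtain ⟨hξI, hξ₀⟩ := hZ' ξ hξ
  refine ⟨ξ, hξI, ?_⟩
  rw [iterate_derivative_C_mul, hQk, sub_eq_zero] at hξ₀
  rw [hξ₀, ← hQ, hc]
  simp only [eval_mul, eval_C, eval_natCast]
  field_simp

theorem abs_prod_le_pow_card {ι : Type*} {T : Finset ι} {w : ι → ℝ} (hw : ∀ i ∈ T, |w i| ≤ h) :
    |∏ i ∈ T, w i| ≤ h ^ T.card := by
  rw [Finset.abs_prod, ← Finset.prod_const]
  exact Finset.prod_le_prod (fun _ _ => abs_nonneg _) hw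

theorem IsDerivChain.abs_le_of_zeros (hU : IsDerivChain k (Icc a b) U)
    (hA : ∀ t ∈ Icc a b, |U k t| ≤ A) (hcard : Z.card = k)
    (hZ : ∀ z ∈ Z, z ∈ Icc a b ∧ U 0 z = 0) (hx : x ∈ Icc a b) :
    |U 0 x| ≤ A * (b - a) ^ k / k.factorial := by
  obtain ⟨ξ, hξ, hU₀⟩ := hU.exists_mul_prod_eq hcard hZ hx
  have hprod : |∏ z ∈ Z, (x - z)| ≤ (b - a) ^ k := by
    rw [← hcard]
    exact abs_prod_le_pow_card fun z hz => Real.dist_le_of_mem_Icc hx (hZ z hz).1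
  rw [le_div_iff₀ (by positivity), ← Nat.abs_cast, ← abs_mul, hU₀, abs_mul]
  exact mul_le_mul (hA ξ hξ) hprod (abs_nonneg _) ((abs_nonneg _).trans (hA ξ hξ))

theorem IsDerivChain.abs_sub_eval_iterate_derivative_le (hG : IsDerivChain k (Icc a b) G)
    (hA : ∀ t ∈ Icc a b, |G k t| ≤ A) (hP : P.degree < k) (hcard : Z.card = k)
    (hZ : ∀ z ∈ Z, z ∈ Icc a b ∧ P.eval z = G 0 z) (hj : j ≤ k) (hx : x ∈ Icc a b) :
    |G j x - (derivative^[j] P).eval x| ≤ A * (b - a) ^ (k - j) / (k - j).factorial := by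
  have hU := hG.sub (isDerivChain_eval_iterate_derivative P k (Icc a b))
  obtain ⟨Z', hcard', hZ'⟩ := (hU.mono hj Subset.rfl).exists_zeros (r := k - j) (Z := Z)
    (by lia) fun z hz => ⟨(hZ z hz).1, by simp [(hZ z hz).2]⟩
  have hshift : IsDerivChain (k - j) (Icc a b)
      fun i t => G (j + i) t - (derivative^[j + i] P).eval t :=
    IsDerivChain.shift (U := fun i t => G i t - (derivative^[i] P).eval t)
      (by rwa [Nat.add_sub_cancel' hj])
  refine hshift.abs_le_of_zeros (fun t ht => ?_) hcard' hZ' hx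
  rw [Nat.add_sub_cancel' hj, iterate_derivative_eq_zero_of_degree_lt hP, eval_zero, sub_zero]
  exact hA t ht

theorem IsSpaced.mul_le_sub (hz : IsSpaced s k z) (hij : i ≤ j) (hj : j ≤ k) :
    ((j : ℝ) - i) * s ≤ z j - z i := by
  induction j, hij using Nat.le_induction with
  | base => simp
  | succ j _ ih =>
    have hstep := hz j hj
    have hprev := ih (by lia)
    push_cast
    linarith

theorem IsSpaced.mul_le_abs_sub (hz : IsSpaced s k z) (hi : i ≤ k) (hj : j ≤ k) :
    |(i : ℝ) - j| * s ≤ |z i - z j| := by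
  wlog hij : j ≤ i generalizing i j
  · rw [abs_sub_comm, abs_sub_comm (z i)]
    exact this hj hi (by lia)
  rw [abs_of_nonneg (sub_nonneg.2 (by exact_mod_cast hij))]
  exact (hz.mul_le_sub hij hi).trans (le_abs_self _)

theorem IsSpaced.injOn (hz : IsSpaced s k z) (hs : 0 < s) :
    InjOn z (Finset.range (k + 1) : Set ℕ) := by
  intro i hi j hj hij
  simp only [Finset.coe_range, mem_Iio, Nat.lt_succ_iff] at hi hj
  have hle := hz.mul_le_abs_sub hi hj
  rw [hij, sub_self, abs_zero] at hle
  have habs : |(i : ℝ) - j| ≤ 0 := nonpos_of_mul_nonpos_left hle hs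
  exact_mod_cast sub_eq_zero.1 (abs_nonpos_iff.1 habs)

theorem prod_erase_abs_sub_natCast (hi : i ≤ k) :
    ∏ j ∈ (Finset.range (k + 1)).erase i, |(i : ℝ) - j| = i.factorial * (k - i).factorial := by
  induction k, hi using Nat.le_induction with
  | base =>
    rw [show (Finset.range (i + 1)).erase i = Finset.range i by grind, Nat.sub_self,
      Nat.factorial_zero, Nat.cast_one, mul_one, ← Finset.prod_range_add_one_eq_factorial,
      ← Finset.prod_range_reflect, Nat.cast_prod]
    refine Finset.prod_congr rfl fun j hj => ?_
    have hji := Finset.mem_range.1 hj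
    have hcast : (i : ℝ) = (i - 1 - j : ℕ) + (j + 1 : ℕ) := by
      exact_mod_cast (by lia : i = i - 1 - j + (j + 1))
    rw [hcast, add_sub_cancel_left, Nat.abs_cast]
  | succ k hik ih =>
    rw [show (Finset.range (k + 1 + 1)).erase i = insert (k + 1) ((Finset.range (k + 1)).erase i) by
        grind,
      Finset.prod_insert (by simp), ih, Nat.succ_sub hik, Nat.factorial_succ, abs_sub_comm,
      ← Nat.cast_sub (by lia), Nat.abs_cast, Nat.succ_sub hik]
    push_cast
    ring

theorem IsSpaced.factorial_mul_pow_le_prod (hz : IsSpaced s k z) (hs : 0 ≤ s) (hi : i ≤ k) :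
    (i.factorial * (k - i).factorial : ℝ) * s ^ k ≤
      ∏ j ∈ (Finset.range (k + 1)).erase i, |z i - z j| := by
  have hcard : ((Finset.range (k + 1)).erase i).card = k := by
    simp [Finset.card_erase_of_mem (Finset.mem_range_succ_iff.2 hi)]
  calc (i.factorial * (k - i).factorial : ℝ) * s ^ k
      = ∏ j ∈ (Finset.range (k + 1)).erase i, |(i : ℝ) - j| * s := by
        rw [Finset.prod_mul_distrib, prod_erase_abs_sub_natCast hi, Finset.prod_const, hcard]
    _ ≤ _ := Finset.prod_le_prod (fun j _ => by positivity) fun j hj =>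
        hz.mul_le_abs_sub hi (Finset.mem_range_succ_iff.1 (Finset.mem_of_mem_erase hj))

theorem abs_sum_powersetCard_prod_le {ι : Type*} {T : Finset ι} {w : ι → ℝ}
    (hw : ∀ i ∈ T, |w i| ≤ h) (r : ℕ) :
    |∑ t ∈ T.powersetCard r, ∏ i ∈ t, w i| ≤ T.card.choose r * h ^ r := by
  rw [← Finset.card_powersetCard, ← nsmul_eq_mul]
  refine (Finset.abs_sum_le_sum_abs _ _).trans (Finset.sum_le_card_nsmul _ _ _ fun t ht => ?_)
  obtain ⟨htT, htr⟩ := Finset.mem_powersetCard.1 ht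
  rw [← htr]
  exact abs_prod_le_pow_card fun i hi => hw i (htT hi)

theorem IsSpaced.abs_eval_iterate_derivative_le (hz : IsSpaced s k z) (hs : 0 < s)
    (hP : P.degree < (k + 1 : ℕ)) (hPz : ∀ i ≤ k, |P.eval (z i)| ≤ ε)
    (hx : ∀ i ≤ k, |x - z i| ≤ h) (hj : j ≤ k) :
    |(derivative^[j] P).eval x| ≤ ε * (2 / s) ^ k * (h ^ (k - j) / (k - j).factorial) := by
  set R := Finset.range (k + 1)
  have hcardR : R.card = k + 1 := Finset.card_range _
  have hterm : ∀ i ∈ R, |P.eval (z i) / (∏ l ∈ R.erase i, (z i - z l)) *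
      ∑ t ∈ (R.erase i).powersetCard (R.card - (j + 1)), ∏ a ∈ t, (x - z a)| ≤
      ε / s ^ k * (k.choose j * h ^ (k - j)) / k.factorial * k.choose i := by
    intro i hi
    have hik : i ≤ k := Finset.mem_range_succ_iff.1 hi
    have hsum := abs_sum_powersetCard_prod_le (T := R.erase i) (w := fun a => x - z a)
      (fun a ha => hx a (Finset.mem_range_succ_iff.1 (Finset.mem_of_mem_erase ha))) (k - j)
    rw [Finset.card_erase_of_mem hi, hcardR, Nat.add_sub_cancel, Nat.choose_symm hj] at hsum
    rw [abs_mul, abs_div, Finset.abs_prod, hcardR, Nat.add_sub_add_right, Nat.cast_choose ℝ hik]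
    calc _ ≤ ε / ((i.factorial * (k - i).factorial : ℝ) * s ^ k) *
            (k.choose j * h ^ (k - j)) := by
          have hprod := hz.factorial_mul_pow_le_prod hs.le hik
          have hεi := hPz i hik
          have hε := (abs_nonneg _).trans hεi
          gcongr
      _ = _ := by field_simp
  rw [Lagrange.eval_iterate_derivative_eq_sum (s := R) (hz.injOn hs) (by rwa [hcardR])
    (by lia) x, abs_mul, Nat.abs_cast]
  calc _ ≤ (j.factorial : ℝ) *
          ∑ i ∈ R, ε / s ^ k * (k.choose j * h ^ (k - j)) / k.factorial * k.choose i := by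
        gcongr
        exact (Finset.abs_sum_le_sum_abs _ _).trans (Finset.sum_le_sum hterm)
    _ = _ := by
        rw [← Finset.mul_sum, ← Nat.cast_sum, Nat.sum_range_choose, Nat.cast_choose ℝ hj, div_pow]
        push_cast
        field_simp

theorem IsDerivChain.abs_le_of_isSpaced (hG : IsDerivChain (k + 1) (Icc a b) G)
    (hA : ∀ t ∈ Icc a b, |G (k + 1) t| ≤ A) (hz : IsSpaced s k z) (hs : 0 < s)
    (hzI : ∀ i ≤ k, z i ∈ Icc a b) (hzG : ∀ i ≤ k, |G 0 (z i)| ≤ ε) (hj : j ≤ k)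
    (hx : x ∈ Icc a b) :
    |G j x| ≤ A * (b - a) ^ (k + 1 - j) / (k + 1 - j).factorial +
      ε * (2 / s) ^ k * ((b - a) ^ (k - j) / (k - j).factorial) := by
  have hinj := hz.injOn hs
  set P := Lagrange.interpolate (Finset.range (k + 1)) z fun i => G 0 (z i)
  have hPz : ∀ i ≤ k, P.eval (z i) = G 0 (z i) := fun i hi =>
    Lagrange.eval_interpolate_at_node _ hinj (Finset.mem_range_succ_iff.2 hi)
  have hP : P.degree < (k + 1 : ℕ) := by
    simpa only [Finset.card_range] using Lagrange.degree_interpolate_lt (fun i => G 0 (z i)) hinj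
  have herror := hG.abs_sub_eval_iterate_derivative_le hA hP
    (Z := (Finset.range (k + 1)).image z) (by simp [Finset.card_image_of_injOn hinj])
    (fun w hw => by
      obtain ⟨i, hi, rfl⟩ := Finset.mem_image.1 hw
      have hik := Finset.mem_range_succ_iff.1 hi
      exact ⟨hzI i hik, hPz i hik⟩) (by lia : j ≤ k + 1) hx
  have hpoly := hz.abs_eval_iterate_derivative_le hs hP
    (fun i hi => (hPz i hi).symm ▸ hzG i hi)
    (fun i hi => Real.dist_le_of_mem_Icc hx (hzI i hi)) hj
  calc |G j x| = |(G j x - (derivative^[j] P).eval x) + (derivative^[j] P).eval x| := by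
        rw [sub_add_cancel]
    _ ≤ _ := (abs_add_le _ _).trans (add_le_add herror hpoly)

theorem exists_isSpaced (hs : 0 < s) (hS : IsCompact S)
    (hvol : ENNReal.ofReal (k * s) < volume S) :
    ∃ z : ℕ → ℝ, IsSpaced s k z ∧ ∀ i ≤ k, z i ∈ S := by
  induction k generalizing S with
  | zero =>
    obtain ⟨x, hx⟩ := nonempty_of_measure_ne_zero hvol.ne_bot
    exact ⟨fun _ => x, fun _ hi => absurd hi (Nat.not_lt_zero _), fun _ _ => hx⟩
  | succ k ih =>
    have hne : S.Nonempty := nonempty_of_measure_ne_zero hvol.ne_bot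
    set x := sInf S
    have hcover : S ⊆ Ico x (x + s) ∪ S ∩ Ici (x + s) := fun y hy =>
      (lt_or_ge y (x + s)).imp (fun hlt => ⟨csInf_le hS.bddBelow hy, hlt⟩) fun hge => ⟨hy, hge⟩
    have hvol' : ENNReal.ofReal (k * s) < volume (S ∩ Ici (x + s)) := by
      have hle := hvol.trans_le ((measure_mono hcover).trans (measure_union_le _ _))
      rw [Nat.cast_succ, add_one_mul, add_comm, ENNReal.ofReal_add hs.le (by positivity),
        Real.volume_Ico, add_sub_cancel_left] at hle
      exact (ENNReal.add_lt_add_iff_left ENNReal.ofReal_ne_top).1 hle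
    obtain ⟨z, hz, hzS⟩ := ih (hS.inter_right isClosed_Ici) hvol'
    refine ⟨fun i => i.casesOn x z, ?_, ?_⟩
    · rintro (_ | i) hi
      · exact (hzS 0 (by lia)).2
      · exact hz i (by lia)
    · rintro (_ | i) hi
      · exact hS.sInf_mem hne
      · exact (hzS i (by lia)).1

theorem exists_volume_div_le_volume_inter_Icc (hS : S ⊆ Icc 0 1) {p : ℕ} (hp : 1 ≤ p) :
    ∃ i < p, volume S / p ≤ volume (S ∩ Icc ((i : ℝ) / p) ((i + 1) / p)) := by
  have hp₀ : (0 : ℝ) < p := by exact_mod_cast hp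
  have hcover : S ⊆ ⋃ i ∈ Finset.range p, S ∩ Icc ((i : ℝ) / p) ((i + 1) / p) := by
    intro t ht
    obtain ⟨ht₀, ht₁⟩ := hS ht
    simp only [Finset.mem_range, mem_iUnion, exists_prop]
    rcases ht₁.eq_or_lt with rfl | ht₁
    · refine ⟨p - 1, by lia, ht, ?_, ?_⟩
      · exact div_le_one_of_le₀ (by exact_mod_cast p.sub_le 1) hp₀.le
      · rw [Nat.cast_pred hp, sub_add_cancel, div_self hp₀.ne']
    · refine ⟨⌊t * p⌋₊, ?_, ht, ?_, ?_⟩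
      · rw [Nat.floor_lt (by positivity)]
        exact mul_lt_of_lt_one_left hp₀ ht₁
      · rw [div_le_iff₀ hp₀]
        exact Nat.floor_le (by positivity)
      · rw [le_div_iff₀ hp₀]
        exact (Nat.lt_floor_add_one _).le
  have hsum : ∑ _ ∈ Finset.range p, volume S / p ≤
      ∑ i ∈ Finset.range p, volume (S ∩ Icc ((i : ℝ) / p) ((i + 1) / p)) := by
    rw [Finset.sum_const, Finset.card_range, nsmul_eq_mul,
      ENNReal.mul_div_cancel (by exact_mod_cast hp₀.ne') (ENNReal.natCast_ne_top p)]
    exact (measure_mono hcover).trans (measure_biUnion_finset_le _ _)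
  obtain ⟨i, hi, hle⟩ :=
    ENNReal.exists_le_of_sum_le (Finset.nonempty_range_iff.2 (by lia)) hsum
  exact ⟨i, Finset.mem_range.1 hi, hle⟩

end Interpolation

/-! ### The Remez inequality on the unit interval -/

section UnitInterval

variable {μ : ℕ → ℝ} {A L a h m s x y γ ε : ℝ} {j k n p r : ℕ} {G : ℕ → ℝ → ℝ} {z : ℕ → ℝ}

theorem pow_div_factorial_le_exp_of_le {c : ℝ} (hx₀ : 0 ≤ x) (hx : x ≤ r * Real.exp (-c)) :
    x ^ r / r.factorial ≤ Real.exp ((1 - c) * r) := by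
  calc x ^ r / r.factorial ≤ (r * Real.exp (-c)) ^ r / r.factorial := by gcongr
    _ = (r : ℝ) ^ r / r.factorial * Real.exp (r * -c) := by rw [mul_pow, Real.exp_nat_mul]; ring
    _ ≤ Real.exp r * Real.exp (r * -c) := by
      gcongr
      exact Real.pow_div_factorial_le_exp _ r.cast_nonneg r
    _ = Real.exp ((1 - c) * r) := by rw [← Real.exp_add]; ring_nf

theorem exists_natCast_le_two_mul (hy : 1 ≤ y) : ∃ p : ℕ, y ≤ p ∧ p ≤ 2 * y :=
  ⟨⌈y⌉₊, Nat.le_ceil y, by linarith [Nat.ceil_lt_add_one (zero_le_one.trans hy)]⟩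

theorem exists_scale (hn : 1 ≤ n) (hL : n ≤ Real.exp 1 * L) :
    ∃ p : ℕ, 1 ≤ p ∧ 2 * n * Real.exp (-5) ≤ L * (1 / p) ∧ L * (1 / p) ≤ n * Real.exp (-3) := by
  have hn₀ : (0 : ℝ) < n := by exact_mod_cast hn
  have hL₀ : 0 < L := pos_of_mul_pos_right (hn₀.trans_le hL) (Real.exp_pos 1).le
  have hy : 1 ≤ L * Real.exp 3 / n := by
    have hexp : Real.exp 1 ≤ Real.exp 3 := Real.exp_le_exp.2 (by norm_num)
    rw [one_le_div hn₀]
    nlinarith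
  obtain ⟨p, hp₁, hp₂⟩ := exists_natCast_le_two_mul hy
  have hp₀ : (0 : ℝ) < p := zero_lt_one.trans_le (hy.trans hp₁)
  have hexp : 4 * Real.exp 3 ≤ Real.exp 5 := by
    have htwo : 2 ≤ Real.exp 1 := by linarith [Real.exp_one_gt_d9]
    have hsplit : Real.exp 5 = Real.exp 1 * Real.exp 1 * Real.exp 3 := by
      rw [← Real.exp_add, ← Real.exp_add]
      norm_num
    have hfour : 4 ≤ Real.exp 1 * Real.exp 1 := by nlinarith
    rw [hsplit]
    exact mul_le_mul_of_nonneg_right hfour (Real.exp_pos 3).le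
  refine ⟨p, by exact_mod_cast hp₀, ?_, ?_⟩
  · rw [← mul_div_assoc, le_div_iff₀ hn₀] at hp₂
    rw [Real.exp_neg, ← div_eq_mul_inv, mul_one_div, div_le_div_iff₀ (Real.exp_pos 5) hp₀]
    nlinarith
  · rw [div_le_iff₀ hn₀] at hp₁
    rw [Real.exp_neg, ← div_eq_mul_inv, mul_one_div, div_le_div_iff₀ hp₀ (Real.exp_pos 3)]
    linarith

theorem majorant_mul_pow_div_factorial_le (hμ : IsAdmissibleWeight μ) (hA : 0 < A) (hh : 0 ≤ h)
    (hn : 1 ≤ n) (hscale : μ (2 * n) * h ≤ n * Real.exp (-3)) (hj : j ≤ n) :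
    majorant μ A (2 * n) * h ^ (2 * n - j) / (2 * n - j).factorial ≤
      1 / 2 * (Real.exp (j - (n + 1)) * majorant μ A j) := by
  have hM := majorant_pos hμ hA j
  have hL := hμ.pos (2 * n) (by lia)
  obtain ⟨r, hr⟩ : ∃ r, 2 * n = j + r := ⟨2 * n - j, by lia⟩
  have hr' : (2 : ℝ) * n = j + r := by exact_mod_cast hr
  have hn' : (1 : ℝ) ≤ n := by exact_mod_cast hn
  have hj' : (j : ℝ) ≤ n := by exact_mod_cast hj
  have hpow : (μ (2 * n) * h) ^ r / r.factorial ≤ Real.exp ((1 - 3) * r) :=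
    pow_div_factorial_le_exp_of_le (by positivity) (hscale.trans (by gcongr; linarith))
  calc majorant μ A (2 * n) * h ^ (2 * n - j) / (2 * n - j).factorial
      ≤ majorant μ A j * μ (2 * n) ^ (2 * n - j) * h ^ (2 * n - j) / (2 * n - j).factorial := by
        gcongr
        exact majorant_le_mul_pow hμ hA (by lia)
    _ = majorant μ A j * ((μ (2 * n) * h) ^ r / r.factorial) := by
        rw [show 2 * n - j = r by lia, mul_pow]
        ring
    _ ≤ majorant μ A j * (Real.exp (-1) * Real.exp (j - (n + 1))) := by
        gcongr
        rw [← Real.exp_add]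
        exact hpow.trans (Real.exp_le_exp.2 (by linarith))
    _ ≤ majorant μ A j * (1 / 2 * Real.exp (j - (n + 1))) := by
        gcongr
        exact Real.exp_neg_one_lt_half.le
    _ = 1 / 2 * (Real.exp (j - (n + 1)) * majorant μ A j) := by ring

theorem mul_pow_mul_exp_le_majorant_mul_pow (hμ : IsAdmissibleWeight μ) (hA : 0 < A) (hh : 0 ≤ h)
    (hn : 1 ≤ n) (hscale : 2 * n * Real.exp (-5) ≤ μ (2 * n) * h) (hγ₀ : 0 ≤ γ)
    (hγ : ∀ i, 1 ≤ i → i ≤ 2 * n → μ (2 * n) * ((i : ℝ) / (2 * n : ℕ)) ^ γ ≤ μ i)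
    (hj : j ≤ 2 * n) :
    A * (2 * n) ^ j * Real.exp (-(5 * j + 2 * n * γ)) ≤ majorant μ A j * h ^ j := by
  calc A * (2 * n) ^ j * Real.exp (-(5 * j + 2 * n * γ))
      = A * ((2 * n * Real.exp (-5)) ^ j * Real.exp (-(2 * n * γ))) := by
        rw [mul_pow _ (Real.exp (-5)), ← Real.exp_nat_mul, neg_add, Real.exp_add]
        ring_nf
    _ ≤ A * ((μ (2 * n) * h) ^ j * Real.exp (-(2 * n * γ))) := by gcongr
    _ = A * (μ (2 * n) ^ j * Real.exp (-((2 * n : ℕ) * γ))) * h ^ j := by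
        rw [mul_pow]
        push_cast
        ring
    _ ≤ majorant μ A j * h ^ j := by
        gcongr
        exact pow_mul_exp_neg_le_majorant hμ hA (by lia) hγ₀ hγ hj

theorem two_div_pow_mul_le {c : ℝ} (hc : 0 < c) (hm : 0 < m) (hh : 0 < h) (hj : j ≤ k) :
    (2 / (m * h / c)) ^ k * (h ^ (k - j) / (k - j).factorial) * h ^ j ≤
      (2 / m) ^ k * (c ^ j * Real.exp c) := by
  obtain ⟨r, rfl⟩ := Nat.exists_eq_add_of_le hj
  rw [Nat.add_sub_cancel_left]
  calc (2 / (m * h / c)) ^ (j + r) * (h ^ r / r.factorial) * h ^ j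
      = (2 / m) ^ (j + r) * (c ^ j * (c ^ r / r.factorial)) := by
        rw [show 2 / (m * h / c) = 2 / m * (c / h) by field_simp, mul_pow, div_pow c, pow_add c,
          pow_add h]
        field_simp
    _ ≤ (2 / m) ^ (j + r) * (c ^ j * Real.exp c) := by
        gcongr
        exact Real.pow_div_factorial_le_exp _ hc.le r

theorem IsWeightJet.majorant_le_of_isSpaced (hμ : IsAdmissibleWeight μ) (hn : 1 ≤ n) (hh : 0 ≤ h)
    (hk : k + 1 = 2 * n) (hG : IsWeightJet μ (2 * n) A (Icc a (a + h)) G)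
    (hscale : μ (2 * n) * h ≤ n * Real.exp (-3)) (hs : 0 < s) (hz : IsSpaced s k z)
    (hzI : ∀ i ≤ k, z i ∈ Icc a (a + h)) (hzG : ∀ i ≤ k, |G 0 (z i)| ≤ ε) (hj : j ≤ n)
    (hlarge : Real.exp (j - (n + 1)) * majorant μ A j < |G j a|) :
    1 / 2 * (Real.exp (j - (n + 1)) * majorant μ A j) ≤
      ε * (2 / s) ^ k * (h ^ (k - j) / (k - j).factorial) := by
  have hremainder := majorant_mul_pow_div_factorial_le hμ hG.pos hh hn hscale hj
  rw [← hk] at hG hremainder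
  have hnodes := hG.chain.abs_le_of_isSpaced (hG.bound (k + 1) le_rfl) hz hs hzI hzG
    (by lia : j ≤ k) (left_mem_Icc.2 (le_add_of_nonneg_right hh))
  rw [add_sub_cancel_left] at hnodes
  linarith

theorem IsWeightJet.exp_mul_le_of_isSpaced (hμ : IsAdmissibleWeight μ) (hn : 1 ≤ n) (hh : 0 < h)
    (hm : 0 < m) (hk : k + 1 = 2 * n) (hG : IsWeightJet μ (2 * n) A (Icc a (a + h)) G)
    (hlower : 2 * n * Real.exp (-5) ≤ μ (2 * n) * h) (hupper : μ (2 * n) * h ≤ n * Real.exp (-3))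
    (hγ₀ : 0 ≤ γ) (hγ : ∀ i, 1 ≤ i → i ≤ 2 * n → μ (2 * n) * ((i : ℝ) / (2 * n : ℕ)) ^ γ ≤ μ i)
    (hz : IsSpaced (m * h / (2 * n)) k z) (hzI : ∀ i ≤ k, z i ∈ Icc a (a + h))
    (hzG : ∀ i ≤ k, |G 0 (z i)| ≤ ε) (hj : j ≤ n)
    (hlarge : Real.exp (j - (n + 1)) * majorant μ A j < |G j a|) :
    1 / 2 * Real.exp (j - (n + 1)) * (A * (2 * n) ^ j * Real.exp (-(5 * j + 2 * n * γ))) ≤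
      ε * ((2 / m) ^ k * ((2 * n) ^ j * Real.exp (2 * n))) := by
  have _hn₀ : (1 : ℝ) ≤ n := by exact_mod_cast hn
  have hε : 0 ≤ ε := (abs_nonneg _).trans (hzG 0 k.zero_le)
  have hmajorant := hG.majorant_le_of_isSpaced hμ hn hh.le hk hupper (by positivity) hz hzI hzG hj
    hlarge
  calc 1 / 2 * Real.exp (j - (n + 1)) * (A * (2 * n) ^ j * Real.exp (-(5 * j + 2 * n * γ)))
      ≤ 1 / 2 * Real.exp (j - (n + 1)) * (majorant μ A j * h ^ j) := by
        exact mul_le_mul_of_nonneg_left (mul_pow_mul_exp_le_majorant_mul_pow hμ hG.pos hh.le hn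
          hlower hγ₀ hγ (hj.trans (by lia))) (by positivity)
    _ = 1 / 2 * (Real.exp (j - (n + 1)) * majorant μ A j) * h ^ j := by ring
    _ ≤ ε * (2 / (m * h / (2 * n))) ^ k * (h ^ (k - j) / (k - j).factorial) * h ^ j := by gcongr
    _ = ε * ((2 / (m * h / (2 * n))) ^ k * (h ^ (k - j) / (k - j).factorial) * h ^ j) := by ring
    _ ≤ ε * ((2 / m) ^ k * ((2 * n) ^ j * Real.exp (2 * n))) := by
        exact mul_le_mul_of_nonneg_left
          (two_div_pow_mul_le (by positivity) hm hh (hj.trans (by lia))) hε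

theorem le_mul_pow_of_exp_mul_le (hn : 1 ≤ n) (hm : 0 < m) (hm₁ : m ≤ 1) (hε : 0 ≤ ε)
    (hk : k + 1 = 2 * n) (hj : j ≤ n)
    (hle : 1 / 2 * Real.exp (j - (n + 1)) * (A * (2 * n) ^ j * Real.exp (-(5 * j + 2 * n * γ))) ≤
      ε * ((2 / m) ^ k * ((2 * n) ^ j * Real.exp (2 * n)))) :
    A ≤ ε * (2 * Real.exp (4 + γ) / m) ^ (2 * n) := by
  have hn₀ : (1 : ℝ) ≤ n := by exact_mod_cast hn
  have hj' : (j : ℝ) ≤ n := by exact_mod_cast hj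
  set w := 1 / 2 * Real.exp (j - (n + 1)) * Real.exp (-(5 * j + 2 * n * γ)) * (2 * n) ^ j with hw
  have hw₀ : 0 < w := by positivity
  have hexp : (2 * n) ^ j * Real.exp (2 * n) ≤ w * (2 * Real.exp (4 + γ) ^ (2 * n)) :=
    calc (2 * n) ^ j * Real.exp (2 * n)
        ≤ (2 * n) ^ j * Real.exp (j - (n + 1) + -(5 * j + 2 * n * γ) + (2 * n : ℕ) * (4 + γ)) := by
          gcongr
          push_cast
          linarith
      _ = w * (2 * Real.exp (4 + γ) ^ (2 * n)) := by
          rw [hw, Real.exp_add, Real.exp_add, Real.exp_nat_mul]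
          ring
  have htwo : 2 ≤ 2 / m := (le_div_iff₀ hm).2 (by linarith)
  refine le_of_mul_le_mul_left ?_ hw₀
  calc w * A ≤ ε * ((2 / m) ^ k * ((2 * n) ^ j * Real.exp (2 * n))) := by
        refine le_trans (le_of_eq ?_) hle
        rw [hw]
        ring
    _ ≤ ε * ((2 / m) ^ k * (w * (2 / m * Real.exp (4 + γ) ^ (2 * n)))) := by
        refine mul_le_mul_of_nonneg_left (mul_le_mul_of_nonneg_left ?_ (by positivity)) hε
        exact hexp.trans (by gcongr)
    _ = w * (ε * (2 * Real.exp (4 + γ) / m) ^ (2 * n)) := by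
        rw [mul_div_right_comm, mul_pow, ← hk]
        ring

theorem IsWeightJet.remez_unitInterval (hμ : IsAdmissibleWeight μ) (hn : 1 ≤ n)
    (hG : IsWeightJet μ (2 * n) A (Icc 0 1) G) (hA : A ≤ |G 0 1|)
    (hsum_lt : weightSum μ 1 n < Real.exp 1) (hle_sum : Real.exp 1 ≤ weightSum μ 1 (n + 1))
    (hγ₀ : 0 ≤ γ) (hγ : ∀ i, 1 ≤ i → i ≤ 2 * n → μ (2 * n) * ((i : ℝ) / (2 * n : ℕ)) ^ γ ≤ μ i)
    {S : Set ℝ} (hS : IsCompact S) (hS₀₁ : S ⊆ Icc 0 1) (hSε : ∀ t ∈ S, |G 0 t| ≤ ε)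
    (hm : 0 < m) (hm₁ : m ≤ 1) (hmS : ENNReal.ofReal m ≤ volume S) :
    A ≤ ε * (2 * Real.exp (4 + γ) / m) ^ (2 * n) := by
  have _hn₀ : (0 : ℝ) < n := by exact_mod_cast hn
  have hμ₂ := hμ.pos (2 * n) (by lia)
  have hL : n ≤ Real.exp 1 * μ (2 * n) := by
    rw [← div_le_iff₀ hμ₂]
    exact (natCast_div_le_weightSum hμ (by lia)).trans hsum_lt.le
  obtain ⟨p, hp, hlower, hupper⟩ := exists_scale hn hL
  have hp₀ : (0 : ℝ) < p := by exact_mod_cast hp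
  obtain ⟨i, hip, hi⟩ := exists_volume_div_le_volume_inter_Icc hS₀₁ hp
  rw [add_div] at hi
  set a := (i : ℝ) / p with ha
  set h := 1 / (p : ℝ) with hh
  have hh₀ : 0 < h := one_div_pos.2 hp₀
  have hah : Icc a (a + h) ⊆ Icc 0 1 := by
    refine Icc_subset_Icc (by positivity) ?_
    rw [ha, hh, ← add_div, div_le_one hp₀]
    exact_mod_cast hip
  obtain ⟨k, hk⟩ : ∃ k, k + 1 = 2 * n := ⟨2 * n - 1, by lia⟩
  have hk' : (k : ℝ) + 1 = 2 * n := by exact_mod_cast hk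
  have hspace : ENNReal.ofReal (k * (m * h / (2 * n))) < volume (S ∩ Icc a (a + h)) :=
    calc ENNReal.ofReal (k * (m * h / (2 * n)))
        < ENNReal.ofReal (m / p) := by
          refine (ENNReal.ofReal_lt_ofReal_iff (by positivity)).2 ?_
          rw [mul_div_assoc', div_lt_iff₀ (by positivity), hh, mul_one_div, mul_comm]
          gcongr
          linarith
      _ = ENNReal.ofReal m / p := by rw [ENNReal.ofReal_div_of_pos hp₀, ENNReal.ofReal_natCast]
      _ ≤ volume (S ∩ Icc a (a + h)) := (ENNReal.div_le_div_right hmS _).trans hi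
  obtain ⟨z, hz, hzS⟩ := exists_isSpaced (by positivity) (hS.inter_right isClosed_Icc) hspace
  obtain ⟨j, hj, hlarge⟩ := (hG.mono (by lia) Subset.rfl).exists_large_deriv hμ (n := n + 1)
    (by lia) (by simpa using hle_sum) hA (hah (left_mem_Icc.2 (le_add_of_nonneg_right hh₀.le)))
  have hzG : ∀ i ≤ k, |G 0 (z i)| ≤ ε := fun i hi => hSε _ (hzS i hi).1
  exact le_mul_pow_of_exp_mul_le hn hm hm₁ ((abs_nonneg _).trans (hzG 0 k.zero_le)) hk
    (Nat.lt_succ_iff.1 hj) ((hG.mono le_rfl hah).exp_mul_le_of_isSpaced hμ hn hh₀ hm hk hlower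
      hupper hγ₀ hγ hz (fun i hi => (hzS i hi).2) hzG (Nat.lt_succ_iff.1 hj)
      (by simpa using hlarge))

end UnitInterval

/-! ### Growth of interpolated weights -/

section Growth

variable {μ : ℕ → ℝ} {g φ φ' : ℝ → ℝ} {a b s : ℝ} {j n : ℕ}

theorem antitoneOn_of_hasDerivWithinAt_Iic_nonpos (hφ : ContinuousOn φ (Icc a b))
    (hφ' : ∀ x ∈ Ioc a b, HasDerivWithinAt φ (φ' x) (Iic x) x) (hle : ∀ x ∈ Ioc a b, φ' x ≤ 0) :
    AntitoneOn φ (Icc a b) := by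
  intro x hx y hy hxy
  have hsub : Icc x y ⊆ Icc a b := Icc_subset_Icc hx.1 hy.2
  have hneg : MapsTo Neg.neg (Icc (-y) (-x)) (Icc x y) := fun u hu =>
    ⟨le_neg_of_le_neg hu.2, neg_le_of_neg_le hu.1⟩
  have hmem : ∀ u ∈ Ico (-y) (-x), -u ∈ Ioc a b := fun u hu =>
    ⟨hx.1.trans_lt (lt_neg_of_lt_neg hu.2), (neg_le_of_neg_le hu.1).trans hy.2⟩
  have hreflect := image_le_of_deriv_right_le_deriv_boundary (f := fun _ => φ y) (f' := fun _ => 0)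
    (B := fun u => φ (-u)) (B' := fun u => -φ' (-u)) continuousOn_const
    (fun u _ => hasDerivWithinAt_const u _ _) (by rw [neg_neg])
    ((hφ.mono hsub).comp continuousOn_neg hneg)
    (fun u hu => ((hφ' (-u) (hmem u hu)).comp u (hasDerivWithinAt_neg u (Ici u))
      fun v hv => neg_le_neg (mem_Ici.1 hv)).congr_deriv (mul_neg_one _))
    (fun u hu => neg_nonneg.2 (hle (-u) (hmem u hu)))
  simpa using hreflect (right_mem_Icc.2 (neg_le_neg hxy))

theorem hasDerivWithinAt_leftDeriv_of_Icc (ha : a < s) (hsb : s ≤ b) (hs : s ≠ 1)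
    (hg : DifferentiableWithinAt ℝ g (Icc a b) s) :
    HasDerivWithinAt g (leftDeriv g s) (Iic s) s := by
  rw [leftDeriv, if_neg hs]
  refine ((hg.mono (Icc_subset_Icc_right hsb)).mono_of_mem_nhdsWithin ?_).hasDerivWithinAt
  exact Icc_mem_nhdsLE ha

theorem leftDeriv_eq_derivWithin_Icc (ha : a < s) (hsb : s ≤ b) (hs : s ≠ 1)
    (hg : DifferentiableWithinAt ℝ g (Icc a b) s) :
    leftDeriv g s = derivWithin g (Icc a b) s := by
  have hunique : UniqueDiffWithinAt ℝ (Icc a s) s := uniqueDiffOn_Icc ha s (right_mem_Icc.2 ha.le)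
  exact hunique.eq_deriv _
    ((hasDerivWithinAt_leftDeriv_of_Icc ha hsb hs hg).mono Icc_subset_Iic_self)
    (hg.hasDerivWithinAt.mono (Icc_subset_Icc_right hsb))

namespace IsInterpolation

theorem hasDerivWithinAt_leftDeriv (h : IsInterpolation μ g) (hs : 1 < s) :
    HasDerivWithinAt g (leftDeriv g s) (Iic s) s := by
  obtain ⟨t, ht, ht₀, htop, hC⟩ := h.piecewise
  have hmem : s ∈ Ioi (t ⊥) := by rwa [Nat.bot_eq_zero, ht₀]
  rw [← iUnion_Ioc_map_succ_eq_Ioi (fun i => ht.monotone i.zero_le)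
    (not_bddAbove_of_tendsto_atTop htop)] at hmem
  obtain ⟨i, hi⟩ := mem_iUnion.1 hmem
  exact hasDerivWithinAt_leftDeriv_of_Icc hi.1 hi.2 hs.ne'
    ((hC i).differentiableOn one_ne_zero s (Ioc_subset_Icc_self hi))

theorem bddAbove_mul_leftDeriv_div (h : IsInterpolation μ g) (n : ℕ) :
    BddAbove (range fun s : Icc (1 : ℝ) n => (s : ℝ) * leftDeriv g s / g s) := by
  obtain ⟨t, ht, ht₀, htop, hC⟩ := h.piecewise
  have ht₁ : ∀ i, 1 ≤ t i := fun i => ht₀ ▸ ht.monotone i.zero_le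
  have hpiece : ∀ i, BddAbove ((fun s => s * leftDeriv g s / g s) '' Ioc (t i) (t (i + 1))) := by
    intro i
    have hcont : ContinuousOn (fun s => s * derivWithin g (Icc (t i) (t (i + 1))) s / g s)
        (Icc (t i) (t (i + 1))) :=
      (continuousOn_id.mul ((hC i).continuousOn_derivWithin
        (uniqueDiffOn_Icc (ht i.lt_succ_self)) le_rfl)).div (hC i).continuousOn
        fun s hs => (h.pos s ((ht₁ i).trans hs.1)).ne'
    refine (isCompact_Icc.bddAbove_image hcont).mono ?_
    rintro _ ⟨s, hs, rfl⟩
    refine ⟨s, Ioc_subset_Icc_self hs, ?_⟩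
    dsimp only
    rw [leftDeriv_eq_derivWithin_Icc hs.1 hs.2 ((ht₁ i).trans_lt hs.1).ne'
      ((hC i).differentiableOn one_ne_zero s (Ioc_subset_Icc_self hs))]
  have hinitial : ∀ i, BddAbove ((fun s => s * leftDeriv g s / g s) '' Icc 1 (t i)) := by
    intro i
    induction i with
    | zero => simp only [ht₀, Icc_self, image_singleton, bddAbove_singleton]
    | succ i ih =>
      rw [← Icc_union_Ioc_eq_Icc (ht₁ i) (ht i.lt_succ_self).le, image_union]
      exact ih.union (hpiece i)
  obtain ⟨i, hi⟩ := (htop.eventually_ge_atTop (n : ℝ)).exists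
  refine (hinitial i).mono ?_
  rintro _ ⟨s, rfl⟩
  exact ⟨s, Icc_subset_Icc_right hi s.2, rfl⟩

theorem mul_leftDeriv_div_le_gammaExp (h : IsInterpolation μ g) (hs : s ∈ Icc (1 : ℝ) n) :
    s * leftDeriv g s / g s ≤ gammaExp g n :=
  le_ciSup (h.bddAbove_mul_leftDeriv_div n) ⟨s, hs⟩

theorem gammaExp_nonneg (h : IsInterpolation μ g) (hn : 1 ≤ n) : 0 ≤ gammaExp g n := by
  have hderiv : 0 ≤ leftDeriv g 1 := by
    rw [leftDeriv, if_pos rfl]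
    exact h.mono.derivWithin_nonneg
  refine le_trans ?_ (h.mul_leftDeriv_div_le_gammaExp (left_mem_Icc.2 (by exact_mod_cast hn)))
  exact div_nonneg (mul_nonneg zero_le_one hderiv) (h.pos 1 le_rfl).le

theorem antitoneOn_log_sub (h : IsInterpolation μ g) (n : ℕ) :
    AntitoneOn (fun s => Real.log (g s) - gammaExp g n * Real.log s) (Icc 1 (n : ℝ)) := by
  refine antitoneOn_of_hasDerivWithinAt_Iic_nonpos
    (φ' := fun s => leftDeriv g s / g s - gammaExp g n * s⁻¹) ?_ (fun s hs => ?_) fun s hs => ?_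
  · exact ((h.cont.mono Icc_subset_Ici_self).log fun s hs => (h.pos s hs.1).ne').sub
      (continuousOn_const.mul (continuousOn_id.log fun s hs => (zero_lt_one.trans_le hs.1).ne'))
  · exact ((h.hasDerivWithinAt_leftDeriv hs.1).log (h.pos s hs.1.le).ne').sub
      ((Real.hasDerivAt_log (zero_lt_one.trans hs.1).ne').hasDerivWithinAt.const_mul _)
  · rw [sub_nonpos, ← div_eq_mul_inv, le_div_iff₀ (zero_lt_one.trans hs.1), mul_comm,
      mul_div_assoc']
    exact h.mul_leftDeriv_div_le_gammaExp (Ioc_subset_Icc_self hs)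

theorem mul_rpow_gammaExp_le (h : IsInterpolation μ g) (hj : 1 ≤ j) (hjn : j ≤ n) :
    μ n * ((j : ℝ) / n) ^ gammaExp g n ≤ μ j := by
  have hj₁ : (1 : ℝ) ≤ j := by exact_mod_cast hj
  have hjn' : (j : ℝ) ≤ n := by exact_mod_cast hjn
  have hlog := h.antitoneOn_log_sub n ⟨hj₁, hjn'⟩ ⟨hj₁.trans hjn', le_rfl⟩ hjn'
  simp only [h.interp j hj, h.interp n (hj.trans hjn)] at hlog
  have hμj := h.isAdmissibleWeight.pos j hj
  have hμn := h.isAdmissibleWeight.pos n (hj.trans hjn)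
  have hj₀ : (0 : ℝ) < j := by linarith
  have hn₀ : (0 : ℝ) < n := by linarith
  rw [← Real.log_le_log_iff (by positivity) hμj, Real.log_mul hμn.ne' (by positivity),
    Real.log_rpow (by positivity), Real.log_div hj₀.ne' hn₀.ne']
  linarith

end IsInterpolation

end Growth

/-! ### Partial derivatives along a line -/

section Words

theorem sum_words_eq_sum_piAntidiag {ι : Type*} [Fintype ι] [DecidableEq ι] (Φ : (ι → ℕ) → ℝ)
    (j : ℕ) :
    ∑ w : Fin j → ι, Φ (∑ k, Pi.single (w k) 1) =
      ∑ α ∈ Finset.piAntidiag Finset.univ j,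
        (j.factorial : ℝ) / (∏ i, ((α i).factorial : ℝ)) * Φ α := by
  have hmonomial : ∀ α : ι → ℕ,
      ∏ i, AddMonoidAlgebra.single (Pi.single i 1 : ι → ℕ) (1 : ℝ) ^ α i =
        AddMonoidAlgebra.single α 1 := by
    intro α
    simp only [AddMonoidAlgebra.single_pow, one_pow, AddMonoidAlgebra.prod_single,
      Finset.prod_const_one]
    congr
    ext i
    simp [Finset.sum_apply, Pi.single_apply]
  have hpow := (Fintype.sum_pow (fun i : ι =>
    AddMonoidAlgebra.single (Pi.single i 1 : ι → ℕ) (1 : ℝ)) j).symm.trans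
      (Finset.sum_pow_eq_sum_piAntidiag _ _ j)
  simp only [hmonomial, AddMonoidAlgebra.prod_single, Finset.prod_const_one] at hpow
  have hsum := congrArg (fun p => Finsupp.linearCombination ℝ Φ p.coeff) hpow
  simp only [← nsmul_eq_mul, AddMonoidAlgebra.coeff_sum, AddMonoidAlgebra.coeff_smul, map_sum,
    map_nsmul, AddMonoidAlgebra.coeff_single, Finsupp.linearCombination_single, one_smul] at hsum
  rw [hsum]
  refine Finset.sum_congr rfl fun α hα => ?_
  have hspec := Nat.multinomial_spec Finset.univ α
  rw [(Finset.mem_piAntidiag.1 hα).1, mul_comm] at hspec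
  have hmultinomial : (Nat.multinomial Finset.univ α : ℝ) = j.factorial / ∏ i, (α i).factorial :=
    eq_div_of_mul_eq (by positivity) (mod_cast hspec)
  rw [nsmul_eq_mul, hmultinomial, Nat.cast_prod]

variable {d j m n : ℕ} {U : Set (EuclideanSpace ℝ (Fin d))}
  {f g : EuclideanSpace ℝ (Fin d) → ℝ} {x v : EuclideanSpace ℝ (Fin d)} {t δ : ℝ}

theorem eqOn_partialDeriv_fderiv (hU : IsOpen U) (hf : ContDiffOn ℝ 1 f U) (i : Fin d) :
    EqOn (partialDeriv i f) (fun x => fderiv ℝ f x (EuclideanSpace.single i 1)) U := fun _ hx =>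
  ((hf.differentiableOn one_ne_zero).differentiableAt (hU.mem_nhds hx)).lineDeriv_eq_fderiv

theorem contDiffOn_partialDeriv (hU : IsOpen U) (hf : ContDiffOn ℝ (m + 1 : ℕ) f U) (i : Fin d) :
    ContDiffOn ℝ m (partialDeriv i f) U := by
  have hfderiv : ContDiffOn ℝ m (fderiv ℝ f) U := hf.fderiv_of_isOpen hU (by norm_cast)
  exact (hfderiv.clm_apply contDiffOn_const).congr
    (eqOn_partialDeriv_fderiv hU (hf.of_le (by norm_cast; lia)) i)

theorem eqOn_partialDeriv_congr (hU : IsOpen U) (hfg : EqOn f g U) (i : Fin d) :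
    EqOn (partialDeriv i f) (partialDeriv i g) U := fun _ hx =>
  (hfg.eventuallyEq_of_mem (hU.mem_nhds hx)).lineDeriv_eq

theorem eqOn_partialDeriv_partialDeriv (hU : IsOpen U) (hf : ContDiffOn ℝ 2 f U) (i k : Fin d) :
    EqOn (partialDeriv i (partialDeriv k f))
      (fun x => fderiv ℝ (fderiv ℝ f) x (EuclideanSpace.single i 1) (EuclideanSpace.single k 1))
      U := by
  intro x hx
  have hfderiv : DifferentiableAt ℝ (fderiv ℝ f) x :=
    ((hf.fderiv_of_isOpen hU (m := 1) (by norm_num)).differentiableOn one_ne_zero).differentiableAt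
      (hU.mem_nhds hx)
  have happly : DifferentiableAt ℝ (fun x => fderiv ℝ f x (EuclideanSpace.single k 1)) x :=
    hfderiv.clm_apply (differentiableAt_const _)
  rw [eqOn_partialDeriv_congr hU (eqOn_partialDeriv_fderiv hU (hf.of_le one_le_two) k) i hx,
    partialDeriv, happly.lineDeriv_eq_fderiv, fderiv_clm_apply hfderiv (differentiableAt_const _)]
  simp

theorem eqOn_partialDeriv_comm (hU : IsOpen U) (hf : ContDiffOn ℝ 2 f U) (i k : Fin d) :
    EqOn (partialDeriv i (partialDeriv k f)) (partialDeriv k (partialDeriv i f)) U := by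
  intro x hx
  have hsymm : IsSymmSndFDerivAt ℝ f x :=
    (hf.contDiffAt (hU.mem_nhds hx)).isSymmSndFDerivAt (by simp)
  rw [eqOn_partialDeriv_partialDeriv hU hf i k hx, eqOn_partialDeriv_partialDeriv hU hf k i hx]
  exact hsymm.eq _ _

/-- The iterated partial derivative `∂_{i₁} ⋯ ∂_{i_j} f` along the word `l = [i₁, …, i_j]`. Unlike
multi-indices, words keep track of the order of differentiation, so differentiating along a line
only prepends letters. -/
noncomputable def wordDeriv (l : List (Fin d)) (f : EuclideanSpace ℝ (Fin d) → ℝ) :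
    EuclideanSpace ℝ (Fin d) → ℝ :=
  l.foldr partialDeriv f

/-- The nondecreasing word in which each letter `i` occurs `α i` times. -/
def sortedWord (α : Fin d → ℕ) : List (Fin d) :=
  (List.finRange d).flatMap fun i => List.replicate (α i) i

theorem multiDeriv_eq_wordDeriv (α : Fin d → ℕ) : multiDeriv α f = wordDeriv (sortedWord α) f := by
  unfold multiDeriv wordDeriv sortedWord
  induction List.finRange d with
  | nil => rfl
  | cons i l ih =>
    rw [List.foldr_cons, List.flatMap_cons, List.foldr_append, ← ih]
    generalize List.foldr _ f l = g
    induction α i with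
    | zero => rfl
    | succ m ih => rw [Function.iterate_succ_apply', ih, List.replicate_succ, List.foldr_cons]

theorem count_sortedWord (α : Fin d → ℕ) (i : Fin d) : (sortedWord α).count i = α i := by
  rw [sortedWord, List.count_flatMap, ← Fin.sum_univ_def]
  simp [List.count_replicate]

theorem sortedWord_perm_ofFn (w : Fin j → Fin d) :
    (sortedWord (∑ k, Pi.single (w k) 1)).Perm (List.ofFn w) := by
  refine List.perm_iff_count.2 fun i => ?_
  rw [count_sortedWord]
  induction j with
  | zero => simp
  | succ j ih =>
    rw [Fin.sum_univ_succ, List.ofFn_succ, List.count_cons, ← ih]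
    simp only [Pi.add_apply, Pi.single_apply, add_comm, beq_iff_eq]
    congr 1
    simp only [eq_comm]

theorem contDiffOn_wordDeriv (hU : IsOpen U) (l : List (Fin d)) (hm : m + l.length ≤ n)
    (hf : ContDiffOn ℝ n f U) : ContDiffOn ℝ m (wordDeriv l f) U := by
  induction l generalizing m with
  | nil => exact hf.of_le (by simpa using hm)
  | cons i l ih =>
    rw [List.length_cons] at hm
    exact contDiffOn_partialDeriv hU (ih (m := m + 1) (by lia)) i

theorem eqOn_wordDeriv_of_perm (hU : IsOpen U) (hf : ContDiffOn ℝ n f U) {l l' : List (Fin d)}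
    (hl : l.Perm l') (hn : l.length ≤ n) : EqOn (wordDeriv l f) (wordDeriv l' f) U := by
  induction hl with
  | nil => exact eqOn_refl _ _
  | cons i _ ih =>
    rw [List.length_cons] at hn
    exact eqOn_partialDeriv_congr hU (ih (by lia)) i
  | swap i k l =>
    simp only [List.length_cons] at hn
    exact eqOn_partialDeriv_comm hU (contDiffOn_wordDeriv hU l (m := 2) (by lia) hf) k i
  | trans h _ ih ih' => exact (ih hn).trans (ih' (h.length_eq ▸ hn))

theorem hasDerivAt_comp_line (hU : IsOpen U) (hg : ContDiffOn ℝ 1 g U) (ht : x + t • v ∈ U) :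
    HasDerivAt (fun t : ℝ => g (x + t • v)) (∑ i, v i * partialDeriv i g (x + t • v)) t := by
  have hfderiv : HasFDerivAt g (fderiv ℝ g (x + t • v)) (x + t • v) :=
    ((hg.differentiableOn one_ne_zero).differentiableAt (hU.mem_nhds ht)).hasFDerivAt
  have hline : HasDerivAt (fun t : ℝ => x + t • v) v t := by
    simpa using ((hasDerivAt_id t).smul_const v).const_add x
  have hv : v = ∑ i, v i • EuclideanSpace.single i (1 : ℝ) := by
    simpa using ((EuclideanSpace.basisFun (Fin d) ℝ).sum_repr v).symm
  refine (hfderiv.comp_hasDerivAt t hline).congr_deriv ?_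
  nth_rewrite 2 [hv]
  rw [map_sum]
  refine Finset.sum_congr rfl fun i _ => ?_
  rw [map_smul, eqOn_partialDeriv_fderiv hU hg i ht, smul_eq_mul]

/-- The derivative of order `j` of `t ↦ f (x + t v)`, expanded over the words of length `j`. -/
noncomputable def lineJet (f : EuclideanSpace ℝ (Fin d) → ℝ) (x v : EuclideanSpace ℝ (Fin d))
    (j : ℕ) (t : ℝ) : ℝ :=
  ∑ w : Fin j → Fin d, (∏ k, v (w k)) * wordDeriv (List.ofFn w) f (x + t • v)

theorem lineJet_zero (f : EuclideanSpace ℝ (Fin d) → ℝ) (x v : EuclideanSpace ℝ (Fin d)) (t : ℝ) :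
    lineJet f x v 0 t = f (x + t • v) := by
  simp [lineJet, wordDeriv]

theorem hasDerivAt_lineJet (hU : IsOpen U) (hf : ContDiffOn ℝ n f U) (ht : x + t • v ∈ U)
    (hj : j < n) : HasDerivAt (lineJet f x v j) (lineJet f x v (j + 1) t) t := by
  have hword : ∀ w : Fin j → Fin d,
      HasDerivAt (fun t : ℝ => (∏ k, v (w k)) * wordDeriv (List.ofFn w) f (x + t • v))
        ((∏ k, v (w k)) * ∑ i, v i * wordDeriv (i :: List.ofFn w) f (x + t • v)) t := fun w =>
    (hasDerivAt_comp_line hU (contDiffOn_wordDeriv hU (List.ofFn w) (m := 1)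
      (by rw [List.length_ofFn]; lia) hf) ht).const_mul _
  refine (HasDerivAt.fun_sum fun w _ => hword w).congr_deriv ?_
  rw [lineJet, ← (Fin.consEquiv fun _ => Fin d).sum_comp, Fintype.sum_prod_type, Finset.sum_comm]
  refine Finset.sum_congr rfl fun w _ => ?_
  rw [Finset.mul_sum]
  refine Finset.sum_congr rfl fun i _ => ?_
  simp only [Fin.consEquiv, Equiv.coe_fn_mk, Fin.prod_univ_succ, Fin.cons_zero, Fin.cons_succ,
    List.ofFn_cons]
  ring

variable {K : Set (EuclideanSpace ℝ (Fin d))}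

theorem abs_le_supNorm (hK : IsCompact K) (hf : ContinuousOn f K) {S : Set _} (hSK : S ⊆ K)
    (hx : x ∈ S) : |f x| ≤ supNorm S f := by
  have hbdd := (hK.bddAbove_image hf.abs).mono (image_mono hSK)
  rw [image_eq_range] at hbdd
  exact le_ciSup hbdd ⟨x, hx⟩

theorem supNorm_congr (hfg : EqOn f g K) : supNorm K f = supNorm K g :=
  iSup_congr fun x => by rw [hfg x.2]

theorem derivNorm_eq_sum_words (hU : IsOpen U) (hKU : K ⊆ U) (hf : ContDiffOn ℝ n f U)
    (hj : j ≤ n) :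
    derivNorm j K f = ∑ w : Fin j → Fin d, supNorm K (wordDeriv (List.ofFn w) f) := by
  rw [derivNorm, ← sum_words_eq_sum_piAntidiag]
  refine Finset.sum_congr rfl fun w _ => supNorm_congr ?_
  rw [multiDeriv_eq_wordDeriv]
  have hperm := sortedWord_perm_ofFn w
  refine (eqOn_wordDeriv_of_perm hU hf hperm ?_).mono hKU
  rwa [hperm.length_eq, List.length_ofFn]

theorem abs_lineJet_le (hK : IsCompact K) (hU : IsOpen U) (hKU : K ⊆ U) (hf : ContDiffOn ℝ n f U)
    (ht : x + t • v ∈ K) (hv : ‖v‖ ≤ δ) (hj : j ≤ n) :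
    |lineJet f x v j t| ≤ δ ^ j * derivNorm j K f := by
  have hδ : 0 ≤ δ := (norm_nonneg v).trans hv
  rw [lineJet, derivNorm_eq_sum_words hU hKU hf hj, Finset.mul_sum]
  refine (Finset.abs_sum_le_sum_abs _ _).trans (Finset.sum_le_sum fun w _ => ?_)
  have hcont : ContinuousOn (wordDeriv (List.ofFn w) f) K :=
    (contDiffOn_wordDeriv hU _ (m := 0) (by simpa using hj) hf).continuousOn.mono hKU
  rw [abs_mul, Finset.abs_prod]
  gcongr
  · calc ∏ k, |v (w k)| ≤ ∏ _ : Fin j, δ :=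
        Finset.prod_le_prod (fun _ _ => abs_nonneg _) fun k _ =>
          (PiLp.norm_apply_le v (w k)).trans hv
      _ = δ ^ j := by simp
  · exact abs_le_supNorm hK hcont subset_rfl ht

theorem IsWeightSmooth.isWeightJet_lineJet {μ : ℕ → ℝ} {M : ℝ} (hK : IsCompact K)
    (hf : IsWeightSmooth μ n M K f) {s : Set ℝ} (hs : ∀ t ∈ s, x + t • v ∈ K) (hv : ‖v‖ ≤ δ) :
    IsWeightJet (fun i => δ * μ i) n M s (lineJet f x v) := by
  obtain ⟨U, hU, hKU, hfU⟩ := hf.contDiff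
  refine ⟨hf.pos, fun j hj t ht => (hasDerivAt_lineJet hU hfU (hKU (hs t ht)) hj).hasDerivWithinAt,
    fun j hj t ht => ?_⟩
  have hδ : 0 ≤ δ := (norm_nonneg v).trans hv
  calc ‖lineJet f x v j t‖ ≤ δ ^ j * derivNorm j K f := abs_lineJet_le hK hU hKU hfU (hs t ht) hv hj
    _ ≤ δ ^ j * majorant μ M j := by
        gcongr
        exact hf.bound j (by exact_mod_cast hj)
    _ = majorant (fun i => δ * μ i) M j := pow_mul_majorant δ μ M j

end Words

/-! ### Polar coordinates around a point -/

section HalfLine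

theorem measure_sdiff_le_measure_sdiff {X : Type*} [MeasurableSpace X] {μ : Measure X} {s t : Set X}
    (hs : MeasurableSet s) (ht : MeasurableSet t) (hst : μ s ≤ μ t) (hfin : μ (s ∩ t) ≠ ∞) :
    μ (s \ t) ≤ μ (t \ s) := by
  rw [← measure_inter_add_sdiff s ht, ← measure_inter_add_sdiff t hs, inter_comm t s] at hst
  exact (ENNReal.add_le_add_iff_left hfin).1 hst

theorem lintegral_Ioc_pow (k : ℕ) {a : ℝ} (ha : 0 ≤ a) :
    ∫⁻ r in Ioc 0 a, ENNReal.ofReal (r ^ k) = ENNReal.ofReal (a ^ (k + 1) / (k + 1)) := by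
  rw [← ofReal_integral_eq_lintegral_ofReal (intervalIntegral.intervalIntegrable_pow _).1,
    ← intervalIntegral.integral_of_le ha]
  · simp
  · filter_upwards [ae_restrict_mem measurableSet_Ioc] with r hr
    exact pow_nonneg hr.1.le _

theorem ofReal_pow_div_le_lintegral_pow (k : ℕ) {A : Set ℝ} (hA : MeasurableSet A)
    (hA₀ : A ⊆ Ioi 0) {a : ℝ} (ha : 0 ≤ a) (haA : ENNReal.ofReal a ≤ volume A) :
    ENNReal.ofReal (a ^ (k + 1) / (k + 1)) ≤ ∫⁻ r in A, ENNReal.ofReal (r ^ k) := by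
  have hvol : volume (Ioc 0 a \ A) ≤ volume (A \ Ioc 0 a) :=
    measure_sdiff_le_measure_sdiff measurableSet_Ioc hA (by simpa using haA)
      ((measure_mono inter_subset_left).trans_lt measure_Ioc_lt_top).ne
  have hdiff : ∫⁻ r in Ioc 0 a \ A, ENNReal.ofReal (r ^ k) ≤
      ∫⁻ r in A \ Ioc 0 a, ENNReal.ofReal (r ^ k) :=
    calc ∫⁻ r in Ioc 0 a \ A, ENNReal.ofReal (r ^ k)
        ≤ ∫⁻ _ in Ioc 0 a \ A, ENNReal.ofReal (a ^ k) :=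
          setLIntegral_mono' (measurableSet_Ioc.diff hA) fun r hr =>
            ENNReal.ofReal_le_ofReal (pow_le_pow_left₀ hr.1.1.le hr.1.2 k)
      _ ≤ ∫⁻ _ in A \ Ioc 0 a, ENNReal.ofReal (a ^ k) := by
          rw [setLIntegral_const, setLIntegral_const]
          gcongr
      _ ≤ ∫⁻ r in A \ Ioc 0 a, ENNReal.ofReal (r ^ k) :=
          setLIntegral_mono' (hA.diff measurableSet_Ioc) fun r hr =>
            ENNReal.ofReal_le_ofReal <| pow_le_pow_left₀ ha
              (not_le.1 fun hra => hr.2 ⟨hA₀ hr.1, hra⟩).le k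
  rw [← lintegral_Ioc_pow k ha, ← lintegral_inter_add_sdiff _ _ hA,
    ← lintegral_inter_add_sdiff _ A measurableSet_Ioc, inter_comm]
  gcongr

end HalfLine

section Polar

variable {V : Type*} [NormedAddCommGroup V] [NormedSpace ℝ V]

/-- The trace of `A` on the open ray from `x` in the direction `θ`, parametrized by the distance
to `x` (for unit vectors `θ`). -/
def radialSection (x θ : V) (A : Set V) : Set ℝ :=
  {r | 0 < r ∧ x + r • θ ∈ A}

/-- The trace of `A` on the segment from `x` to `y`, parametrized by `[0, 1]`. -/
def chordSection (x y : V) (A : Set V) : Set ℝ :=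
  Icc 0 1 ∩ AffineMap.lineMap x y ⁻¹' A

theorem radialSection_sdiff (x θ : V) (A B : Set V) :
    radialSection x θ (A \ B) = radialSection x θ A \ radialSection x θ B := by
  ext r
  simp only [radialSection, Set.mem_sdiff, mem_ofPred_eq]
  tauto

theorem exists_radialSection_eq_Ioc {K : Set V} {x θ : V} (hK : IsCompact K)
    (hKx : StarConvex ℝ x K) (hθ : θ ≠ 0) (hne : (radialSection x θ K).Nonempty) :
    ∃ R > 0, x + R • θ ∈ K ∧ radialSection x θ K = Ioc 0 R := by
  obtain ⟨r₀, hr₀, hr₀K⟩ := hne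
  have hray : Topology.IsClosedEmbedding fun r : ℝ => x + r • θ :=
    (Homeomorph.addLeft x).isClosedEmbedding.comp (isClosedEmbedding_smul_left hθ)
  obtain ⟨R, hRK, hRmax⟩ := (hray.isCompact_preimage hK).exists_isGreatest ⟨r₀, hr₀K⟩
  refine ⟨R, hr₀.trans_le (hRmax hr₀K), hRK, Subset.antisymm (fun r hr => ⟨hr.1, hRmax hr.2⟩) ?_⟩
  rintro r ⟨hr₀, hrR⟩
  have hR : 0 < R := hr₀.trans_le hrR
  have hr := hKx.add_smul_sub_mem hRK (div_nonneg hr₀.le hR.le) ((div_le_one hR).2 hrR)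
  rw [add_sub_cancel_left, smul_smul, div_mul_cancel₀ _ hR.ne'] at hr
  exact ⟨hr₀, hr⟩

open scoped Pointwise in
theorem volume_Ioc_inter_radialSection_le {E : Set V} {x θ : V} {R : ℝ} (hR : 0 < R) :
    volume (Ioc 0 R ∩ radialSection x θ E) ≤
      ENNReal.ofReal R * volume (chordSection x (x + R • θ) E) := by
  have hsubset : Ioc 0 R ∩ radialSection x θ E ⊆
      R • chordSection x (x + R • θ) E := by
    rintro r ⟨⟨hr₀, hrR⟩, -, hrE⟩
    refine mem_smul_set.2 ⟨r / R, ⟨⟨(div_pos hr₀ hR).le, (div_le_one hR).2 hrR⟩, ?_⟩, ?_⟩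
    · rwa [mem_preimage, AffineMap.lineMap_apply_module', add_sub_cancel_left, smul_smul,
        div_mul_cancel₀ _ hR.ne', add_comm]
    · rw [smul_eq_mul, mul_div_cancel₀ _ hR.ne']
  refine (measure_mono hsubset).trans_eq ?_
  rw [Measure.addHaar_smul, Module.finrank_self, pow_one, abs_of_pos hR]

theorem volume_chordSection_comm (x y : V) (A : Set V) :
    volume (chordSection y x A) = volume (chordSection x y A) := by
  have hpreimage : (fun t : ℝ => 1 - t) ⁻¹' chordSection x y A = chordSection y x A := by
    ext t
    simp only [chordSection, mem_preimage, mem_inter_iff, AffineMap.lineMap_apply_one_sub,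
      ← Icc.mem_iff_one_sub_mem]
  rw [← hpreimage]
  exact (Measure.measurePreserving_sub_left volume (1 : ℝ)).measure_preimage_emb
    (MeasurableEquiv.subLeft (1 : ℝ)).measurableEmbedding _

variable [MeasurableSpace V] [BorelSpace V]

theorem measurableSet_radialSection {A : Set V} (hA : MeasurableSet A) (x θ : V) :
    MeasurableSet (radialSection x θ A) :=
  measurableSet_Ioi.inter
    ((by fun_prop : Continuous fun r : ℝ => x + r • θ).measurable hA)

theorem ofReal_pow_mul_lintegral_radialSection_le {K E : Set V} {x θ : V} {m : ℝ} (k : ℕ)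
    (hK : IsCompact K) (hKx : StarConvex ℝ x K) (hE : MeasurableSet E) (hm₀ : 0 ≤ m) (hm₁ : m ≤ 1)
    (hθ : θ ≠ 0)
    (hKE : ∀ y ∈ K, volume (chordSection x y E) ≤ ENNReal.ofReal m) :
    ENNReal.ofReal ((1 - m) ^ (k + 1)) * ∫⁻ r in radialSection x θ K, ENNReal.ofReal (r ^ k) ≤
      ∫⁻ r in radialSection x θ (K \ E), ENNReal.ofReal (r ^ k) := by
  obtain hempty | hne := (radialSection x θ K).eq_empty_or_nonempty
  · simp [hempty]
  obtain ⟨R, hR, hRK, hKR⟩ := exists_radialSection_eq_Ioc hK hKx hθ hne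
  have hvol : ENNReal.ofReal ((1 - m) * R) ≤ volume (radialSection x θ (K \ E)) :=
    calc ENNReal.ofReal ((1 - m) * R)
        = ENNReal.ofReal R - ENNReal.ofReal R * ENNReal.ofReal m := by
          rw [← ENNReal.ofReal_mul hR.le, ← ENNReal.ofReal_sub _ (by positivity)]
          ring_nf
      _ ≤ volume (Ioc 0 R) - volume (Ioc 0 R ∩ radialSection x θ E) := by
          rw [Real.volume_Ioc, sub_zero]
          gcongr
          exact (volume_Ioc_inter_radialSection_le hR).trans (by gcongr; exact hKE _ hRK)
      _ ≤ volume (radialSection x θ (K \ E)) := by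
          rw [radialSection_sdiff, hKR, ← sdiff_inter_self_eq_sdiff, inter_comm]
          exact le_measure_sdiff
  have hmeas : MeasurableSet (radialSection x θ (K \ E)) := by
    rw [radialSection_sdiff, hKR]
    exact measurableSet_Ioc.diff (measurableSet_radialSection hE x θ)
  rw [hKR, lintegral_Ioc_pow k hR.le, ← ENNReal.ofReal_mul (pow_nonneg (sub_nonneg.2 hm₁) _),
    ← mul_div_assoc, ← mul_pow]
  exact ofReal_pow_div_le_lintegral_pow k hmeas (fun r hr => hr.1)
    (mul_nonneg (sub_nonneg.2 hm₁) hR.le) hvol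

variable [FiniteDimensional ℝ V] [Nontrivial V] (μ : Measure V) [μ.IsAddHaarMeasure]

theorem measure_eq_lintegral_radialSection {A : Set V} (hA : MeasurableSet A) (x : V) :
    μ A = ∫⁻ θ : Metric.sphere (0 : V) 1, (∫⁻ r in radialSection x θ A,
      ENNReal.ofReal (r ^ (Module.finrank ℝ V - 1))) ∂μ.toSphere := by
  have hray : Measurable fun p : Metric.sphere (0 : V) 1 × Ioi (0 : ℝ) =>
      x + (p.2 : ℝ) • (p.1 : V) :=
    Continuous.measurable (by fun_prop)
  set B := (fun p : Metric.sphere (0 : V) 1 × Ioi (0 : ℝ) => x + (p.2 : ℝ) • (p.1 : V)) ⁻¹' A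
    with hB
  have hBm : MeasurableSet B := hray hA
  have hpolar := μ.measurePreserving_homeomorphUnitSphereProd.measure_preimage hBm.nullMeasurableSet
  have hpreimage : homeomorphUnitSphereProd V ⁻¹' B = Subtype.val ⁻¹' ((x + ·) ⁻¹' A) := by
    ext w
    simp only [hB, mem_preimage, homeomorphUnitSphereProd_apply_fst_coe,
      homeomorphUnitSphereProd_apply_snd_coe]
    rw [smul_smul, mul_inv_cancel₀ (norm_ne_zero_iff.2 w.2), one_smul]
  rw [hpreimage, comap_subtype_coe_apply (measurableSet_singleton _).compl,
    Subtype.image_preimage_coe, Measure.prod_apply hBm, inter_comm, ← sdiff_eq,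
    measure_sdiff_null (measure_singleton _), measure_preimage_add] at hpolar
  rw [hpolar]
  refine lintegral_congr fun θ => ?_
  rw [Measure.volumeIoiPow, withDensity_apply _ (measurable_prodMk_left hBm),
    setLIntegral_subtype measurableSet_Ioi _ fun r : ℝ => ENNReal.ofReal (r ^ _)]
  congr 2
  ext r
  simp [hB, radialSection, and_comm]

theorem exists_lt_volume_chordSection {K E : Set V} {x : V} {m : ℝ} (hK : IsCompact K)
    (hKx : StarConvex ℝ x K) (hE : MeasurableSet E) (hm₀ : 0 ≤ m) (hm₁ : m ≤ 1)
    (hKE : μ (K \ E) < ENNReal.ofReal ((1 - m) ^ Module.finrank ℝ V) * μ K) :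
    ∃ y ∈ K, ENNReal.ofReal m < volume (chordSection x y E) := by
  contrapose! hKE
  obtain ⟨k, hk⟩ := Nat.exists_eq_add_of_le' (Module.finrank_pos (R := ℝ) (M := V))
  have hKm : MeasurableSet K := hK.measurableSet
  rw [measure_eq_lintegral_radialSection μ hKm x,
    measure_eq_lintegral_radialSection μ (hKm.diff hE) x, hk, Nat.add_sub_cancel,
    ← lintegral_const_mul' _ _ ENNReal.ofReal_ne_top]
  exact lintegral_mono fun θ => ofReal_pow_mul_lintegral_radialSection_le k hK hKx hE hm₀ hm₁
    (ne_zero_of_mem_unit_sphere θ) hKE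

theorem exists_half_le_volume_chordSection {K E : Set V} {x : V} {m : ℝ} (hK : IsCompact K)
    (hKx : StarConvex ℝ x K) (hK₀ : μ K ≠ 0) (hE : MeasurableSet E) (hm : 0 < m) (hm₁ : m ≤ 1)
    (hKE : μ (K \ E) ≤ ENNReal.ofReal ((1 - m) ^ Module.finrank ℝ V) * μ K) :
    ∃ y ∈ K, ENNReal.ofReal (m / 2) ≤ volume (chordSection x y E) := by
  have hpow : (1 - m) ^ Module.finrank ℝ V < (1 - m / 2) ^ Module.finrank ℝ V :=
    pow_lt_pow_left₀ (by linarith) (by linarith) Module.finrank_pos.ne'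
  have hlt : μ (K \ E) < ENNReal.ofReal ((1 - m / 2) ^ Module.finrank ℝ V) * μ K := by
    refine hKE.trans_lt (ENNReal.mul_lt_mul_left hK₀ hK.measure_ne_top ?_)
    exact (ENNReal.ofReal_lt_ofReal_iff_of_nonneg (pow_nonneg (by linarith) _)).2 hpow
  obtain ⟨y, hy, hyE⟩ :=
    exists_lt_volume_chordSection μ hK hKx hE (by linarith) (by linarith) hlt
  exact ⟨y, hy, hyE.le⟩

end Polar

/-! ### The integer associated with the data -/

section AssociatedInteger

theorem startIndex_one : startIndex 1 = 0 := by
  simp [startIndex]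

variable {μ : ℕ → ℝ} {n : ℕ}

theorem le_weightDegree_one (hn : weightSum μ 1 n < Real.exp 1) : n ≤ weightDegree μ 1 := by
  rw [weightDegree, startIndex_one]
  exact le_biSup (fun k : ℕ => (k : ℕ∞)) hn

theorem weightSum_lt_of_weightDegree_one_eq (hμ : ∀ j, 1 ≤ j → 0 ≤ μ j)
    (hn : weightDegree μ 1 = n) : weightSum μ 1 n < Real.exp 1 := by
  by_contra! hle
  have hlt : ∀ k, weightSum μ 1 k < Real.exp 1 → k < n := fun k hk => by
    by_contra! hnk
    exact (hle.trans (Finset.sum_le_sum_of_subset_of_nonneg (Finset.Icc_subset_Icc_right hnk)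
      fun i hi _ => one_div_nonneg.2 (hμ i (Finset.mem_Icc.1 hi).1))).not_gt hk
  obtain ⟨k, rfl⟩ := Nat.exists_eq_add_of_lt (hlt 0 (by simp [weightSum, Real.exp_pos]))
  have hdegree : weightDegree μ 1 ≤ k := by
    rw [weightDegree, startIndex_one]
    exact iSup₂_le fun i hi => by exact_mod_cast (by have := hlt i hi; lia : i ≤ k)
  rw [hn] at hdegree
  have : 0 + k + 1 ≤ k := by exact_mod_cast hdegree
  lia

theorem exp_one_le_weightSum_of_weightDegree_one_eq (hn : weightDegree μ 1 = n) :
    Real.exp 1 ≤ weightSum μ 1 (n + 1) := by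
  by_contra! hlt
  have hdegree := le_weightDegree_one hlt
  rw [hn] at hdegree
  exact absurd (Nat.cast_le.1 hdegree) (by lia)

variable {d : ℕ} {K : Set (EuclideanSpace ℝ (Fin d))}

theorem IsAssociatedInteger.weightDegree_eq (h : IsAssociatedInteger μ K (n + 1)) :
    weightDegree (fun j => Metric.diam K * μ j) 1 = n := by
  rw [IsAssociatedInteger, Nat.cast_add_one] at h
  exact (ENat.add_left_injective_of_ne_top ENat.one_ne_top h).symm

theorem IsAssociatedInteger.diam_pos (h : IsAssociatedInteger μ K (n + 1)) :
    0 < Metric.diam K := by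
  refine Metric.diam_nonneg.lt_of_ne' fun hdiam => ?_
  have hle := exp_one_le_weightSum_of_weightDegree_one_eq h.weightDegree_eq
  simp only [hdiam, weightSum, zero_mul, div_zero, Finset.sum_const_zero] at hle
  exact hle.not_gt (Real.exp_pos 1)

theorem IsAssociatedInteger.dim_ne_zero (h : IsAssociatedInteger μ K (n + 1)) : d ≠ 0 := by
  rintro rfl
  exact h.diam_pos.ne' (Metric.diam_subsingleton K.subsingleton_of_subsingleton)

end AssociatedInteger

/-! ### The Remez inequality on star-convex sets -/

section StarConvex

variable {d : ℕ} {K : Set (EuclideanSpace ℝ (Fin d))} {f : EuclideanSpace ℝ (Fin d) → ℝ}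
  {x : EuclideanSpace ℝ (Fin d)}

theorem supNorm_le (hx : x ∈ K) (hmax : IsMaxOn (fun y => |f y|) K x) : supNorm K f ≤ |f x| :=
  have : Nonempty K := ⟨⟨x, hx⟩⟩
  ciSup_le fun y => hmax y.2

theorem IsWeightSmooth.le_of_volume_chordSection {μ : ℕ → ℝ} {μt : ℝ → ℝ} {n : ℕ} {M ε m : ℝ}
    {E : Set (EuclideanSpace ℝ (Fin d))} {y : EuclideanSpace ℝ (Fin d)}
    (hf : IsWeightSmooth μ (2 * n : ℕ) M K f) (hK : IsCompact K) (hKx : StarConvex ℝ x K)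
    (hassoc : IsAssociatedInteger μ K (n + 1)) (hn : 1 ≤ n) (hμt : IsInterpolation μ μt)
    (hM : M ≤ |f x|) (hE : IsCompact E) (hEε : ∀ z ∈ E, |f z| ≤ ε) (hy : y ∈ K)
    (hm : 0 < m) (hm₁ : m ≤ 1) (hmE : ENNReal.ofReal m ≤ volume (chordSection x y E)) :
    M ≤ ε * (2 * Real.exp (4 + gammaExp μt (2 * n)) / m) ^ (2 * n) := by
  have hδ := hassoc.diam_pos
  have hweight := hμt.isAdmissibleWeight.const_mul hδ
  have hx : x ∈ K := hKx.mem ⟨y, hy⟩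
  have hlineMap : ∀ t : ℝ, y + t • (x - y) = AffineMap.lineMap y x t := fun t => by
    rw [AffineMap.lineMap_apply_module', add_comm]
  have hjet : IsWeightJet (fun i => Metric.diam K * μ i) (2 * n) M (Icc 0 1)
      (lineJet f y (x - y)) := by
    refine hf.isWeightJet_lineJet hK (fun t ht => ?_) ?_
    · rw [hlineMap, ← AffineMap.lineMap_apply_one_sub, AffineMap.lineMap_apply_module', add_comm]
      exact hKx.add_smul_sub_mem hy (by linarith [ht.2]) (by linarith [ht.1])
    · rw [← dist_eq_norm]
      exact Metric.dist_le_diam_of_mem hK.isBounded hx hy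
  have hcompact : IsCompact (chordSection y x E) :=
    isCompact_Icc.inter_right (hE.isClosed.preimage AffineMap.lineMap_continuous)
  refine hjet.remez_unitInterval hweight hn ?_
    (weightSum_lt_of_weightDegree_one_eq (fun j hj => (hweight.pos j hj).le) hassoc.weightDegree_eq)
    (exp_one_le_weightSum_of_weightDegree_one_eq hassoc.weightDegree_eq)
    (hμt.gammaExp_nonneg (by lia)) (fun i hi hin => ?_) hcompact inter_subset_left
    (fun t ht => ?_) hm hm₁ (hmE.trans_eq (volume_chordSection_comm x y E).symm)
  · rwa [lineJet_zero, one_smul, add_sub_cancel]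
  · rw [mul_assoc]
    exact mul_le_mul_of_nonneg_left (hμt.mul_rpow_gammaExp_le hi hin) hδ.le
  · rw [lineJet_zero, hlineMap]
    exact hEε _ ht.2

/-- If `E` has volume `w` in a star-convex body of volume `v` in dimension `d`, then some chord from
the center meets `E` in this proportion, up to an arbitrarily small error. The value is the `m` with
`(1 - m) ^ d * v = v - w`. -/
noncomputable def chordProportion (d : ℕ) (v w : ℝ) : ℝ :=
  1 - (v - w) ^ (1 / (d : ℝ)) / v ^ (1 / (d : ℝ))

variable {v w : ℝ}

theorem chordProportion_pos (hd : d ≠ 0) (hw : 0 < w) (hwv : w ≤ v) :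
    0 < chordProportion d v w := by
  have hv := hw.trans_le hwv
  rw [chordProportion, sub_pos, div_lt_one (by positivity)]
  exact Real.rpow_lt_rpow (sub_nonneg.2 hwv) (by linarith) (by positivity)

theorem chordProportion_le_one (hw : 0 ≤ w) (hwv : w ≤ v) : chordProportion d v w ≤ 1 :=
  sub_le_self 1 (div_nonneg (Real.rpow_nonneg (sub_nonneg.2 hwv) _)
    (Real.rpow_nonneg (hw.trans hwv) _))

theorem one_sub_chordProportion_pow_mul (hd : d ≠ 0) (hw : 0 < w) (hwv : w ≤ v) :
    (1 - chordProportion d v w) ^ d * v = v - w := by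
  have hv := hw.trans_le hwv
  rw [chordProportion, sub_sub_cancel, div_pow, one_div, Real.rpow_inv_natCast_pow hv.le hd,
    Real.rpow_inv_natCast_pow (sub_nonneg.2 hwv) hd, div_mul_cancel₀ _ hv.ne']

theorem mul_rpow_div_rpow_sub_rpow (C : ℝ) (hv : 0 < v) :
    C * v ^ (1 / (d : ℝ)) / (v ^ (1 / (d : ℝ)) - (v - w) ^ (1 / (d : ℝ))) =
      C / chordProportion d v w := by
  have hv' : v ^ (1 / (d : ℝ)) ≠ 0 := (Real.rpow_pos_of_pos hv _).ne'
  rw [chordProportion, one_sub_div hv', div_div_eq_mul_div]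

theorem exists_half_chordProportion_le_volume {E F : Set (EuclideanSpace ℝ (Fin d))} (hd : d ≠ 0)
    (hK : IsCompact K) (hKx : StarConvex ℝ x K) (hF : MeasurableSet F) (hEF : E ⊆ F) (hFK : F ⊆ K)
    (hE : 0 < volume E) :
    ∃ y ∈ K, ENNReal.ofReal (chordProportion d (volume K).toReal (volume E).toReal / 2) ≤
      volume (chordSection x y F) := by
  have : Nonempty (Fin d) := ⟨⟨0, Nat.pos_of_ne_zero hd⟩⟩
  have hfin := hK.measure_ne_top (μ := volume)
  have hEK := measure_mono (μ := volume) (hEF.trans hFK)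
  have hE₀ := ENNReal.toReal_pos hE.ne' (ne_top_of_le_ne_top hfin hEK)
  have hEK' := ENNReal.toReal_mono hfin hEK
  refine exists_half_le_volume_chordSection volume hK hKx (hE.trans_le hEK).ne' hF
    (chordProportion_pos hd hE₀ hEK') (chordProportion_le_one hE₀.le hEK') ?_
  calc volume (K \ F) = volume K - volume F :=
        measure_sdiff hFK hF.nullMeasurableSet (ne_top_of_le_ne_top hfin (measure_mono hFK))
    _ ≤ volume K - volume E := by gcongr
    _ = ENNReal.ofReal ((1 - chordProportion d (volume K).toReal (volume E).toReal) ^ d) *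
        volume K := by
      nth_rw 3 [← ENNReal.ofReal_toReal hfin]
      rw [← ENNReal.ofReal_mul' ENNReal.toReal_nonneg, one_sub_chordProportion_pow_mul hd hE₀ hEK',
        ← ENNReal.toReal_sub_of_le hEK hfin, ENNReal.ofReal_toReal (ENNReal.sub_ne_top hfin)]
    _ = _ := by rw [finrank_euclideanSpace_fin]

end StarConvex

end RemezSmooth

open RemezSmooth in
theorem mainTheorem5_general {d : ℕ} {μ : ℕ → ℝ} {μt : ℝ → ℝ}
    {K : Set (EuclideanSpace ℝ (Fin d))} {N : ℕ} {x : EuclideanSpace ℝ (Fin d)}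
    {f : EuclideanSpace ℝ (Fin d) → ℝ} {E : Set (EuclideanSpace ℝ (Fin d))}
    (hK : IsCompact K) (hKx : StarConvex ℝ x K) (hassoc : IsAssociatedInteger μ K N) (hN : 2 ≤ N)
    (hμt : IsInterpolation μ μt)
    (hf : IsWeightSmooth μ ((2 * (N - 1) : ℕ) : ℕ∞) (supNorm K f) K f)
    (hmax : IsMaxOn (fun y => |f y|) K x) (hEK : E ⊆ K) (hE : 0 < volume E) :
    supNorm K f ≤
      (gammaConst μt (2 * (N - 1)) * (volume K).toReal ^ (1 / (d : ℝ)) /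
        ((volume K).toReal ^ (1 / (d : ℝ)) -
          ((volume K).toReal - (volume E).toReal) ^ (1 / (d : ℝ)))) ^ (2 * (N - 1)) *
      supNorm E f := by
  obtain ⟨n, rfl⟩ := Nat.exists_eq_add_of_le' (one_le_two.trans hN)
  rw [Nat.add_sub_cancel] at hf ⊢
  have hx : x ∈ K := hKx.mem ((nonempty_of_measure_ne_zero hE.ne').mono hEK)
  have hcont : ContinuousOn f K :=
    let ⟨_, _, hKU, hfU⟩ := hf.contDiff
    hfU.continuousOn.mono hKU
  have hF : IsCompact (K ∩ {y | |f y| ≤ supNorm E f}) :=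
    hK.of_isClosed_subset (hcont.abs.preimage_isClosed_of_isClosed hK.isClosed isClosed_Iic)
      inter_subset_left
  have hE₀ := ENNReal.toReal_pos hE.ne' ((measure_mono hEK).trans_lt hK.measure_lt_top).ne
  have hEK' := ENNReal.toReal_mono hK.measure_ne_top (measure_mono (μ := volume) hEK)
  obtain ⟨y, hy, hyF⟩ := exists_half_chordProportion_le_volume hassoc.dim_ne_zero hK hKx
    hF.measurableSet (fun z hz => ⟨hEK hz, abs_le_supNorm hK hcont hEK hz⟩) inter_subset_left hE
  have hm := chordProportion_pos hassoc.dim_ne_zero hE₀ hEK'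
  refine (hf.le_of_volume_chordSection hK hKx hassoc (by lia) hμt (supNorm_le hx hmax) hF
    (fun z hz => hz.2) hy (half_pos hm)
    ((half_le_self hm.le).trans (chordProportion_le_one hE₀.le hEK')) hyF).trans_eq ?_
  rw [mul_rpow_div_rpow_sub_rpow _ (hE₀.trans_le hEK'), gammaConst, mul_comm, div_div_eq_mul_div]
  ring_nf

theorem mainTheorem5 {d : ℕ} (hd : 1 ≤ d) (μ : ℕ → ℝ) (μt : ℝ → ℝ)
    (K : Set (EuclideanSpace ℝ (Fin d))) (N : ℕ)
    (hdata : RemezSmooth.IsAdmissibleData μ K)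
    (hassoc : RemezSmooth.IsAssociatedInteger μ K N)
    (hN : 2 ≤ N)
    (hμt : RemezSmooth.IsInterpolation μ μt)
    (f : EuclideanSpace ℝ (Fin d) → ℝ)
    (hf : RemezSmooth.IsWeightSmooth μ ((2 * (N - 1) : ℕ) : ℕ∞) (RemezSmooth.supNorm K f) K f)
    (E : Set (EuclideanSpace ℝ (Fin d))) (hEK : E ⊆ K)
    (hE : NullMeasurableSet E volume) (hEpos : 0 < volume E) :
    RemezSmooth.supNorm K f ≤
      (RemezSmooth.gammaConst μt (2 * (N - 1)) * (volume K).toReal ^ (1 / (d : ℝ)) /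
        ((volume K).toReal ^ (1 / (d : ℝ)) -
          ((volume K).toReal - (volume E).toReal) ^ (1 / (d : ℝ)))) ^ (2 * (N - 1)) *
      RemezSmooth.supNorm E f := by
  obtain ⟨U, -, hKU, hfU⟩ := hf.contDiff
  obtain ⟨x, hx, hmax⟩ := hdata.convexBody.compact.exists_isMaxOn
    (hdata.convexBody.interior_nonempty.mono interior_subset) (hfU.continuousOn.mono hKU).abs
  exact mainTheorem5_general hdata.convexBody.compact (hdata.convexBody.convex.starConvex hx)
    hassoc hN hμt hf hmax hEK hEpos
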